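/- For each sample size $n$ consider variable selection in the regression $y\sim N(X\theta,\phi I_n)$, where $X$ is an $n\times p$ matrix ($p$ may depend on $n$), over a set of candidate models $M_k$. Each model is a subset of $p_k$ columns, with design matrix $X_k$ and $X_k'X_k$ invertible; let $\bar p=\max_k p_k$. Prior model probabilities $p(M_k)>0$ depend on $k$ only through $p_k$. Given $M_k$, the prior is the pMOM prior $$p(\theta_k\mid\phi,M_k)=N(\theta_k;0,\tau\phi V_k)\prod_{j\in M_k}\frac{\theta_j^2\,x_j'x_j}{\tau\phi},\qquad V_k=\mathrm{diag}(X_k'X_k)^{-1},$$ with dispersion $\tau>0$ (which may depend on $n$), and $\phi\sim \mathrm{IG}(a_\phi/2,l_\phi/2)$ with fixed $a_\phi,l_\phi>0$. The data are generated from $f^*=N(X_t\theta_t^*,\phi^*I_n)$ for a candidate model $M_t$ with $p_t\ge 1$. Let $M_m$ be a spurious candidate model, i.e. $M_t\subsetneq M_m$. All these quantities may depend on $n$. Write $r_{p_m,p_t}=p(M_m)/p(M_t)$, let $\rho_{k1}\ge\dots\ge\rho_{kp_k}$ be the eigenvalues of $V_kX_k'X_k$, let $\lambda_{t0}=(X_t\theta_t^*)'(X_t\theta_t^*)/\phi^*$,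 and let $a_n\ll b_n$ mean $a_n/b_n\to0$ as $n\to\infty$. Let $$D_{mt}=\frac{E_m}{E_t},\qquad E_k=\int\!\!\int \prod_{j\in M_k}\frac{\theta_j^2\,x_j'x_j}{\tau\phi}\;N(\theta_k;\tilde\theta_k,\phi\tilde V_k)\,\mathrm{IG}\!\left(\phi;\tfrac{a_\phi+n}{2},\tfrac{\tilde s_k}{2}\right)d\theta_k\,d\phi,$$ where $\tilde V_k^{-1}=X_k'X_k+V_k^{-1}/\tau$, $\tilde\theta_k=\tilde V_kX_k'y$ and $\tilde s_k=l_\phi+y'y-y'X_k\tilde V_kX_k'y$. Assume: (B1) $\bar p\ll\min\{n,p\}$ and $\tau\gg\bar p$; (C1) $\tau\gg1$ and $r_{p_m,p_t}\ll\tau^{\beta_2(p_m-p_t)/2}$ for some fixed $\beta_2\in(0,1)$; (D1) for some constant $c>0$, $\prod_{j=1}^{p_m}(\tau\rho_{mj}+1)^{1/2}\big/\prod_{j=1}^{p_t}(\tau\rho_{tj}+1)^{1/2}\asymp(c\tau)^{(p_m-p_t)/2}$; (D2) $\lambda_{t0}\ll\tau\rho_{tp_t}$. Then for every sequence $h_n\to\infty$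 and all fixed $\alpha\in(0,1)$ and $\kappa>0$ there is a sequence $$b_n\ll\max\left\{r_{p_m,p_t}^{\alpha}\,(h_n\sqrt\tau)^{\alpha(p_t-p_m)},\;e^{-\kappa n},\;e^{-\tau\rho_{tp_t}/2}\right\}$$ such that, for all sufficiently large $n$, $$E_{f^*}\big(p(M_m\mid y)\big)\le b_n+P_{f^*}\!\left(D_{mt}>h_n^{-(p_m-p_t)}\right).$$ -/

import Mathlib

open MeasureTheory ProbabilityTheory Filter Topology Asymptotics
open scoped BigOperators Matrix

noncomputable section

namespace MomSelection

/-- Density at `x` of the multivariate normal law with mean `μ` and covariance matrix `S`. -/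
def normalPDF {ι : Type*} [Fintype ι] [DecidableEq ι]
    (μ : ι → ℝ) (S : Matrix ι ι ℝ) (x : ι → ℝ) : ℝ :=
  Real.exp (-(1 / 2) * ((x - μ) ⬝ᵥ (S⁻¹ *ᵥ (x - μ)))) /
    Real.sqrt ((2 * Real.pi) ^ Fintype.card ι * S.det)

/-- Density at `φ > 0` of the inverse gamma law with shape `a` and scale `b`. -/
def invGammaPDF (a b φ : ℝ) : ℝ :=
  b ^ a / Real.Gamma a * φ ^ (-a - 1) * Real.exp (-b / φ)

section Model

variable {n p : ℕ} (X : Matrix (Fin n) (Fin p) ℝ) (k : Finset (Fin p))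

/-- The design matrix `X_k` of the model that selects the columns in `k`. -/
def design : Matrix (Fin n) k ℝ := X.submatrix id (fun j => (j : Fin p))

/-- The Gram matrix `X_k' X_k`. -/
def gram : Matrix k k ℝ := (design X k)ᵀ * design X k

/-- The prior scale matrix `V_k = diag(X_k' X_k)⁻¹`. -/
def priorScale : Matrix k k ℝ := (Matrix.diagonal fun j => gram X k j j)⁻¹

/-- The MOM penalty `∏_{j ∈ k} θ_j² x_j'x_j / (τ φ)`. -/
def penalty (τ φ : ℝ) (θ : k → ℝ) : ℝ :=
  ∏ j, θ j ^ 2 * gram X k j j / (τ * φ)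

/-- The pMOM prior density of `θ_k` given `φ`. -/
def pMOM (τ φ : ℝ) (θ : k → ℝ) : ℝ :=
  normalPDF 0 ((τ * φ) • priorScale X k) θ * penalty X k τ φ θ

/-- The integrated likelihood `p(y | M_k)` for Gaussian errors with variance `φ`,
under the pMOM prior on `θ_k` given `φ` and an `IG(a / 2, l / 2)` prior on `φ`. -/
def marginalLik (τ a l : ℝ) (y : Fin n → ℝ) : ℝ :=
  ∫ φ in Set.Ioi (0 : ℝ), ∫ θ : k → ℝ,
    normalPDF (design X k *ᵥ θ) (φ • (1 : Matrix (Fin n) (Fin n) ℝ)) y *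
      pMOM X k τ φ θ * invGammaPDF (a / 2) (l / 2) φ

/-- The posterior probability `p(M_k | y)` over the candidate set `models`, with prior model
probabilities `prior`. -/
def postProb (models : Finset (Finset (Fin p))) (prior : Finset (Fin p) → ℝ)
    (τ a l : ℝ) (y : Fin n → ℝ) : ℝ :=
  marginalLik X k τ a l y * prior k / ∑ i ∈ models, marginalLik X i τ a l y * prior i

/-- `Ṽ_k = (X_k'X_k + V_k⁻¹ / τ)⁻¹`. -/
def postScale (τ : ℝ) : Matrix k k ℝ := (gram X k + τ⁻¹ • (priorScale X k)⁻¹)⁻¹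

/-- `θ̃_k = Ṽ_k X_k' y`. -/
def postMean (τ : ℝ) (y : Fin n → ℝ) : k → ℝ :=
  postScale X k τ *ᵥ ((design X k)ᵀ *ᵥ y)

/-- `s̃_k = l + y'y - y' X_k Ṽ_k X_k' y`. -/
def postSS (τ l : ℝ) (y : Fin n → ℝ) : ℝ :=
  l + y ⬝ᵥ y - ((design X k)ᵀ *ᵥ y) ⬝ᵥ (postScale X k τ *ᵥ ((design X k)ᵀ *ᵥ y))

/-- The expectation of the MOM penalty when `θ_k | φ ∼ N(θ̃_k, φ Ṽ_k)` and
`φ ∼ IG((a + n) / 2, s̃_k / 2)`. -/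
def postPenalty (τ a l : ℝ) (y : Fin n → ℝ) : ℝ :=
  ∫ φ in Set.Ioi (0 : ℝ), ∫ θ : k → ℝ,
    normalPDF (postMean X k τ y) (φ • postScale X k τ) θ *
      invGammaPDF ((a + n) / 2) (postSS X k τ l y / 2) φ * penalty X k τ φ θ

/-- The eigenvalues `ρ_{k1}, …, ρ_{kp_k}` of `V_k X_k' X_k`, with multiplicity. -/
def eigs : Multiset ℝ := (priorScale X k * gram X k).charpoly.roots

/-- The smallest eigenvalue `ρ_{kp_k}` of `V_k X_k' X_k`, for a nonempty model. -/
def minEig : ℝ := sInf {ρ | ρ ∈ eigs X k}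

/-- `∏_j (τ ρ_{kj} + 1)^{1/2}`. -/
def eigProd (τ : ℝ) : ℝ := ((eigs X k).map fun ρ => (τ * ρ + 1) ^ (1 / 2 : ℝ)).prod

/-- `D_{kl}`, the ratio of the posterior expected MOM penalties of the models `k` and `l`. -/
def penaltyRatio (k l : Finset (Fin p)) (τ a lφ : ℝ) (y : Fin n → ℝ) : ℝ :=
  postPenalty X k τ a lφ y / postPenalty X l τ a lφ y

end Model

/-- The law `N(μ, φ I)` on `ℝⁿ`. -/
def truth {n : ℕ} (μ : Fin n → ℝ) (φ : ℝ) : Measure (Fin n → ℝ) :=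
  Measure.pi fun i => gaussianReal (μ i) φ.toNNReal

/-- The data of a variable selection problem with sample size `n`. -/
structure Problem (n : ℕ) where
  /-- number of available variables -/
  p : ℕ
  /-- the design matrix -/
  X : Matrix (Fin n) (Fin p) ℝ
  /-- the candidate models, as sets of columns -/
  models : Finset (Finset (Fin p))
  /-- prior model probabilities -/
  prior : Finset (Fin p) → ℝ
  /-- prior dispersion -/
  τ : ℝ
  /-- the data-generating model -/
  t : Finset (Fin p)
  /-- the data-generating regression coefficients -/
  θstar : t → ℝ
  /-- the data-generating error variance -/
  φstar : ℝ
  /-- the model under study -/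
  m : Finset (Fin p)

namespace Problem

variable {n : ℕ} (P : Problem n)

/-- The standing assumptions; the last three fields say that `m` is a spurious model,
i.e. a candidate which strictly contains `t`. -/
structure IsAdmissible : Prop where
  tau_pos : 0 < P.τ
  phi_pos : 0 < P.φstar
  prior_pos : ∀ k ∈ P.models, 0 < P.prior k
  prior_sum : ∑ k ∈ P.models, P.prior k = 1
  prior_size : ∀ k ∈ P.models, ∀ l ∈ P.models, k.card = l.card → P.prior k = P.prior l
  gram_isUnit : ∀ k ∈ P.models, IsUnit (gram P.X k)
  t_nonempty : P.t.Nonempty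
  t_mem : P.t ∈ P.models
  m_mem : P.m ∈ P.models
  t_ssubset_m : P.t ⊂ P.m

/-- The maximum model size. -/
def pbar : ℕ := P.models.sup Finset.card

/-- The prior odds `r_{p_m,p_t} = p(M_m) / p(M_t)`. -/
def r : ℝ := P.prior P.m / P.prior P.t

/-- `p_m - p_t`, as a real number. -/
def excess : ℝ := (P.m.card : ℝ) - (P.t.card : ℝ)

/-- The mean `X_t θ_t*` of the data. -/
def mean : Fin n → ℝ := design P.X P.t *ᵥ P.θstar

/-- The data-generating law `N(X_t θ_t*, φ* I)`. -/
def law : Measure (Fin n → ℝ) := truth P.mean P.φstar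

/-- The non-centrality parameter `λ_{t0} = (X_t θ_t*)'(X_t θ_t*) / φ*`. -/
def noncentrality : ℝ := P.mean ⬝ᵥ P.mean / P.φstar

end Problem

end MomSelection

end

/-! Write q = p_m - p_t. The posterior odds of m against t factor exactly as r · D_mt · (inverse
ratio of eigenvalue products) · (s̃_t / s̃_m)^{(a+n)/2} (`odds_eq`). Where D_mt ≤ h^{-q}, that bound
replaces D_mt and only the last factor is random. A probability is at most 1, so it is at most
odds^{α'} for any α' in (α, 1). The fractional power is essential: the moment bound below needs
residual degrees of freedom exceeding α'(a+n), which fails for α' = 1.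

Completing the square shows that s̃_k is l plus the minimum of a ridge loss. Hence s̃_t - s̃_m is a
positive semidefinite quadratic form in y, bounded by the identity and zero on data whose ridge fit
under m has no coefficient outside t. On the noise it is at most the squared projection to a space U
of dimension at most q; on the signal it is at most ‖X_tθ‖²/(τρ), negligible by (D2). Meanwhile s̃_m
is at least l plus the squared projection of the noise to the orthogonal complement K of the columns
of X_m. As K ⟂ U, the two projections are independent Gaussians (`postSS_ratio_le`,
`map_orthogonalProjection_stdGaussian`).

The analytic core is E(1 + u/(l + ‖v‖²))^γ ≤ e^{u/2} for a standard Gaussian v in dimension at least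
2γ + 2, obtained from the radial substitution t² = s² + u. Bernoulli's inequality shrinks u by a
factor θ < 1, so that averaging over U stays finite and costs only κ₀^{-q/2}. Such constants to the
power q are absorbed by h^{-q(α'-α)}, which the gap between α' and α provides (`rate_le`). -/

noncomputable section

namespace MomSelection

/-! ### Standard Gaussian measures: density, radial moments, orthogonal projections. -/

section Gaussian

open Set Module
open scoped ENNReal RealInnerProductSpace

variable {E : Type*} [NormedAddCommGroup E] [InnerProductSpace ℝ E]

variable (E) in
/-- The constant `(2π)^{-d/2}` of the standard normal density. -/
def stdConst : ℝ := ((2 * Real.pi) ^ (finrank ℝ E / 2 : ℝ))⁻¹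

variable (E) in
lemma stdConst_pos : 0 < stdConst E := by
  unfold stdConst; positivity

variable [FiniteDimensional ℝ E] [MeasurableSpace E] [BorelSpace E]

lemma integrable_exp_neg_mul_sq_norm {b : ℝ} (hb : 0 < b) :
    Integrable (fun v : E => Real.exp (-b * ‖v‖ ^ 2)) := by
  have h := (GaussianFourier.integrable_cexp_neg_mul_sq_norm_add
    (b := (b : ℂ)) (by simpa using hb) 0 (0 : E)).norm
  refine h.congr (ae_of_all _ fun v => ?_)
  simp only [Complex.norm_exp]
  congr 1
  simp [← Complex.ofReal_pow]

lemma lintegral_exp_neg_mul_sq_norm {b : ℝ} (hb : 0 < b) :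
    ∫⁻ v : E, ENNReal.ofReal (stdConst E * Real.exp (-(b / 2) * ‖v‖ ^ 2)) =
      ENNReal.ofReal (b ^ (-(finrank ℝ E / 2 : ℝ))) := by
  rw [← ofReal_integral_eq_lintegral_ofReal
    ((integrable_exp_neg_mul_sq_norm (by positivity)).const_mul _)
    (ae_of_all _ fun v => mul_nonneg (stdConst_pos E).le (Real.exp_pos _).le),
    integral_const_mul, GaussianFourier.integral_rexp_neg_mul_sq_norm (by positivity)]
  congr 1
  rw [stdConst, show Real.pi / (b / 2) = (2 * Real.pi) * b⁻¹ by field_simp,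
    Real.mul_rpow (x := 2 * Real.pi) (by positivity) (by positivity), Real.inv_rpow hb.le,
    Real.rpow_neg hb.le]
  have : 0 < (2 * Real.pi) ^ (finrank ℝ E / 2 : ℝ) := by positivity
  field_simp

-- Both measures are finite and have the same characteristic function, which determines them.
variable (E) in
lemma stdGaussian_eq_withDensity :
    stdGaussian E = volume.withDensity fun v : E =>
      ENNReal.ofReal (stdConst E * Real.exp (-(1 / 2) * ‖v‖ ^ 2)) := by
  have hfin : IsFiniteMeasure (volume.withDensity fun v : E =>
      ENNReal.ofReal (stdConst E * Real.exp (-(1 / 2) * ‖v‖ ^ 2))) := by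
    refine isFiniteMeasure_withDensity ?_
    rw [lintegral_exp_neg_mul_sq_norm one_pos]
    exact ENNReal.ofReal_ne_top
  refine Measure.ext_of_charFun (funext fun t => ?_)
  rw [charFun_stdGaussian, charFun_apply,
    integral_withDensity_eq_integral_toReal_smul (by fun_prop) (ae_of_all _ fun _ => by simp)]
  have key := GaussianFourier.integral_cexp_neg_mul_sq_norm_add (V := E)
    (b := (1 / 2 : ℂ)) (by norm_num) Complex.I t
  have : ∀ v : E, (ENNReal.ofReal (stdConst E * Real.exp (-(1 / 2) * ‖v‖ ^ 2))).toReal •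
      Complex.exp (⟪v, t⟫ * Complex.I) = (stdConst E : ℂ) *
        Complex.exp (-(1 / 2) * ‖v‖ ^ 2 + Complex.I * ⟪t, v⟫) := by
    intro v
    rw [ENNReal.toReal_ofReal (mul_nonneg (stdConst_pos E).le (Real.exp_pos _).le),
      Complex.exp_add, real_inner_comm]
    simp [Complex.real_smul, mul_assoc, mul_comm Complex.I]
  simp_rw [this]
  rw [integral_const_mul, key, stdConst]
  have h2 : (Real.pi / (1 / 2) : ℂ) ^ (finrank ℝ E / 2 : ℂ) =
      (((2 * Real.pi) ^ (finrank ℝ E / 2 : ℝ) : ℝ) : ℂ) := by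
    rw [Complex.ofReal_cpow (by positivity)]
    congr 1
    · push_cast; ring
    · push_cast; ring
  rw [h2, ← mul_assoc, ← Complex.ofReal_mul, inv_mul_cancel₀ (by positivity)]
  simp only [Complex.I_sq, Complex.ofReal_one, one_mul]
  congr 1
  ring

lemma lintegral_stdGaussian {f : E → ℝ≥0∞} (hf : Measurable f) :
    ∫⁻ v, f v ∂stdGaussian E =
      ∫⁻ v, ENNReal.ofReal (stdConst E * Real.exp (-(1 / 2) * ‖v‖ ^ 2)) * f v := by
  rw [stdGaussian_eq_withDensity, lintegral_withDensity_eq_lintegral_mul _ (by fun_prop) hf]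
  rfl

/-- The chi-squared moment generating function: tilting leaves a Gaussian kernel of precision 1 - c.
-/
lemma lintegral_exp_sq_norm_stdGaussian {c : ℝ} (hc : c < 1) :
    ∫⁻ v, ENNReal.ofReal (Real.exp (c / 2 * ‖v‖ ^ 2)) ∂stdGaussian E =
      ENNReal.ofReal ((1 - c) ^ (-(finrank ℝ E / 2 : ℝ))) := by
  rw [lintegral_stdGaussian (by fun_prop), ← lintegral_exp_neg_mul_sq_norm (sub_pos.2 hc)]
  refine lintegral_congr fun v => ?_
  rw [← ENNReal.ofReal_mul (mul_nonneg (stdConst_pos E).le (Real.exp_pos _).le), mul_assoc,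
    ← Real.exp_add]
  congr 3
  ring

/-- Polar coordinates for the lower integral, so that no integrability is required. -/
lemma lintegral_fun_norm [Nontrivial E] {f : ℝ → ℝ≥0∞} (hf : Measurable f) :
    ∫⁻ x : E, f ‖x‖ = (volume : Measure E).toSphere univ *
      ∫⁻ y in Ioi (0 : ℝ), ENNReal.ofReal (y ^ (finrank ℝ E - 1)) * f y := by
  calc
    ∫⁻ x : E, f ‖x‖ = ∫⁻ x : ({(0)}ᶜ : Set E), f ‖x.1‖ ∂(volume.comap Subtype.val) := by
      rw [lintegral_subtype_comap (measurableSet_singleton _).compl fun x : E => f ‖x‖,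
        restrict_compl_singleton]
    _ = ∫⁻ x, f x.2 ∂(volume : Measure E).toSphere.prod (.volumeIoiPow (finrank ℝ E - 1)) := by
      have := (volume : Measure E).measurePreserving_homeomorphUnitSphereProd.lintegral_comp
        (f := fun x => f x.2) (by fun_prop)
      rw [← this]
      simp only [homeomorphUnitSphereProd_apply_snd_coe]
    _ = (volume : Measure E).toSphere univ *
        ∫⁻ x : Ioi (0 : ℝ), f x ∂.volumeIoiPow (finrank ℝ E - 1) := by
      rw [lintegral_prod _ (by fun_prop)]
      simp only [lintegral_const]
      rw [mul_comm]
    _ = _ := by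
      congr 1
      rw [Measure.volumeIoiPow, lintegral_withDensity_eq_lintegral_mul _ (by fun_prop)
        (by fun_prop), ← lintegral_subtype_comap measurableSet_Ioi]
      rfl

/-- With t = √(s² + u), the power is at most (t/s)^{2γ} ≤ (t/s)^{d-2}, and s^{d-1}(t/s)^{d-2} =
(s/t) t^{d-1}, where s/t = dt/ds. The factor e^{u/2} comes from s² = t² - u. -/
lemma radial_substitution {d : ℕ} {u l γ s : ℝ} (hu : 0 ≤ u) (hl : 0 ≤ l)
    (hγ : 0 ≤ γ) (hd : 2 * γ + 2 ≤ d) (hs : 0 < s) :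
    s ^ (d - 1) * (Real.exp (-(1 / 2) * s ^ 2) * (1 + u / (l + s ^ 2)) ^ γ) ≤
      Real.exp (u / 2) * (s / √(s ^ 2 + u) *
        (√(s ^ 2 + u) ^ (d - 1) * Real.exp (-(1 / 2) * √(s ^ 2 + u) ^ 2))) := by
  have hd2 : 2 ≤ d := by
    have : (2 : ℝ) ≤ d := by linarith
    exact_mod_cast this
  obtain ⟨e, rfl⟩ := Nat.exists_eq_add_of_le hd2
  have hpos : 0 < s ^ 2 + u := by positivity
  set t := √(s ^ 2 + u) with ht
  have ht0 : 0 < t := Real.sqrt_pos.2 hpos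
  have ht2 : t ^ 2 = s ^ 2 + u := Real.sq_sqrt hpos.le
  have h1 : (1 + u / (l + s ^ 2)) ^ γ ≤ (t / s) ^ e := by
    have h2 : 1 + u / (l + s ^ 2) ≤ (t / s) ^ 2 := by
      rw [div_pow, ht2, add_div, div_self (by positivity)]
      gcongr
      linarith
    have h3 : 1 ≤ t / s := by
      rw [one_le_div hs]
      exact Real.le_sqrt_of_sq_le (by linarith)
    calc (1 + u / (l + s ^ 2)) ^ γ ≤ ((t / s) ^ 2) ^ γ := by
          exact Real.rpow_le_rpow (by positivity) h2 hγ
      _ = (t / s) ^ (2 * γ) := by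
          rw [← Real.rpow_natCast, ← Real.rpow_mul (by positivity)]; norm_num
      _ ≤ (t / s) ^ (e : ℝ) := by
          refine Real.rpow_le_rpow_of_exponent_le h3 ?_
          push_cast at hd
          linarith
      _ = (t / s) ^ e := Real.rpow_natCast _ _
  have h4 : Real.exp (-(1 / 2) * t ^ 2) = Real.exp (-(1 / 2) * s ^ 2) * Real.exp (-(u / 2)) := by
    rw [ht2, ← Real.exp_add]; congr 1; ring
  have h5 : Real.exp (u / 2) * Real.exp (-(u / 2)) = 1 := by rw [← Real.exp_add]; simp
  rw [show 2 + e - 1 = e + 1 by omega, h4]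
  calc _ ≤ s ^ (e + 1) * (Real.exp (-(1 / 2) * s ^ 2) * (t / s) ^ e) := by gcongr
    _ = Real.exp (-(1 / 2) * s ^ 2) * (s * t ^ e) := by
      rw [div_pow]; field_simp; ring
    _ = Real.exp (-(1 / 2) * s ^ 2) * (Real.exp (u / 2) * Real.exp (-(u / 2))) * (s * t ^ e) := by
      rw [h5]; ring
    _ = _ := by field_simp; ring

/-- After the substitution t lies in a subset of the positive axis; enlarging it to the whole axis
gives the bound. -/
lemma lintegral_radial_le {d : ℕ} {u l γ : ℝ} (hu : 0 ≤ u) (hl : 0 ≤ l)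
    (hγ : 0 ≤ γ) (hd : 2 * γ + 2 ≤ d) :
    ∫⁻ s in Ioi (0 : ℝ), ENNReal.ofReal (s ^ (d - 1)) *
        ENNReal.ofReal (Real.exp (-(1 / 2) * s ^ 2) * (1 + u / (l + s ^ 2)) ^ γ) ≤
      ENNReal.ofReal (Real.exp (u / 2)) * ∫⁻ s in Ioi (0 : ℝ), ENNReal.ofReal (s ^ (d - 1)) *
        ENNReal.ofReal (Real.exp (-(1 / 2) * s ^ 2)) := by
  set G : ℝ → ℝ≥0∞ := fun s => ENNReal.ofReal (s ^ (d - 1)) *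
        ENNReal.ofReal (Real.exp (-(1 / 2) * s ^ 2)) with hG
  have hsubst := lintegral_image_eq_lintegral_deriv_mul_of_monotoneOn
    (s := Ioi (0 : ℝ)) (f := fun s => √(s ^ 2 + u)) (f' := fun s => s / √(s ^ 2 + u))
    measurableSet_Ioi
    (fun s hs => by
      have hs' : (0 : ℝ) < s := hs
      have h := ((hasDerivAt_pow 2 s).add_const u).sqrt (by positivity)
      refine (h.congr_deriv ?_).hasDerivWithinAt
      field_simp
      norm_num)
    (fun s hs t ht hst => by
      have hs' : (0 : ℝ) < s := hs
      exact Real.sqrt_le_sqrt (by gcongr)) G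
  have himg : (fun s : ℝ => √(s ^ 2 + u)) '' Ioi 0 ⊆ Ioi 0 := by
    rintro _ ⟨s, hs, rfl⟩
    have hs' : (0 : ℝ) < s := hs
    exact Real.sqrt_pos.2 (by positivity)
  calc _ ≤ ∫⁻ s in Ioi (0 : ℝ), ENNReal.ofReal (Real.exp (u / 2)) *
        (ENNReal.ofReal (s / √(s ^ 2 + u)) * G (√(s ^ 2 + u))) := by
        refine setLIntegral_mono' measurableSet_Ioi fun s hs => ?_
        have hs' : (0 : ℝ) < s := hs
        simp only [hG]
        rw [← ENNReal.ofReal_mul (by positivity), ← ENNReal.ofReal_mul (by positivity),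
          ← ENNReal.ofReal_mul (by positivity), ← ENNReal.ofReal_mul (by positivity)]
        exact ENNReal.ofReal_le_ofReal (radial_substitution hu hl hγ hd hs')
    _ = ENNReal.ofReal (Real.exp (u / 2)) *
        ∫⁻ s in (fun s : ℝ => √(s ^ 2 + u)) '' Ioi 0, G s := by
        rw [lintegral_const_mul' _ _ ENNReal.ofReal_ne_top, hsubst]
    _ ≤ _ := by
        gcongr

lemma lintegral_rpow_stdGaussian_le {u l γ : ℝ} (hu : 0 ≤ u) (hl : 0 ≤ l)
    (hγ : 0 ≤ γ) (hd : 2 * γ + 2 ≤ finrank ℝ E) :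
    ∫⁻ v, ENNReal.ofReal ((1 + u / (l + ‖v‖ ^ 2)) ^ γ) ∂stdGaussian E ≤
      ENNReal.ofReal (Real.exp (u / 2)) := by
  have hnt : Nontrivial E := by
    refine Module.nontrivial_of_finrank_pos (R := ℝ) ?_
    have : (0 : ℝ) < finrank ℝ E := by linarith
    exact_mod_cast this
  -- Total mass 1 in polar form; it removes the sphere area and the normalising constant at the end.
  have hone := lintegral_exp_neg_mul_sq_norm (E := E) one_pos
  simp only [Real.one_rpow, ENNReal.ofReal_one] at hone
  simp_rw [ENNReal.ofReal_mul (stdConst_pos E).le] at hone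
  rw [lintegral_const_mul' _ _ ENNReal.ofReal_ne_top,
    lintegral_fun_norm (f := fun s => ENNReal.ofReal (Real.exp (-(1 / 2) * s ^ 2)))
      (by fun_prop)] at hone
  rw [lintegral_stdGaussian (by fun_prop)]
  calc _ = ∫⁻ v : E, ENNReal.ofReal (stdConst E) * ENNReal.ofReal
        (Real.exp (-(1 / 2) * ‖v‖ ^ 2) * (1 + u / (l + ‖v‖ ^ 2)) ^ γ) := by
        refine lintegral_congr fun v => ?_
        rw [ENNReal.ofReal_mul (stdConst_pos E).le, mul_assoc, ← ENNReal.ofReal_mul (by positivity)]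
    _ ≤ ENNReal.ofReal (stdConst E) * ((volume : Measure E).toSphere univ *
        (ENNReal.ofReal (Real.exp (u / 2)) * ∫⁻ s in Ioi (0 : ℝ),
          ENNReal.ofReal (s ^ (finrank ℝ E - 1)) *
            ENNReal.ofReal (Real.exp (-(1 / 2) * s ^ 2)))) := by
        rw [lintegral_const_mul' _ _ ENNReal.ofReal_ne_top,
          lintegral_fun_norm (f := fun s => ENNReal.ofReal (Real.exp (-(1 / 2) * s ^ 2) *
            (1 + u / (l + s ^ 2)) ^ γ)) (by fun_prop)]
        gcongr
        exact lintegral_radial_le hu hl hγ hd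
    _ = ENNReal.ofReal (Real.exp (u / 2)) := by
        rw [mul_left_comm _ (ENNReal.ofReal (Real.exp (u / 2))), mul_left_comm, hone, mul_one]

/-- Orthogonal projections of a standard Gaussian vector to orthogonal subspaces are independent
and standard Gaussian. -/
lemma map_orthogonalProjection_stdGaussian {K U : Submodule ℝ E} (hKU : K ⟂ U) :
    (stdGaussian E).map (fun v => (K.orthogonalProjectionOnto v, U.orthogonalProjectionOnto v)) =
      (stdGaussian K).prod (stdGaussian U) := by
  have hm : Measurable fun v : E => (K.orthogonalProjectionOnto v, U.orthogonalProjectionOnto v) := by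
    fun_prop
  have := Measure.isProbabilityMeasure_map (μ := stdGaussian E) hm.aemeasurable
  refine charFun_eq_prod_iff.1 fun t => ?_
  rw [charFun_apply, integral_map (by fun_prop) (by fun_prop),
    integral_map (by fun_prop) (by fun_prop)]
  -- Self-adjointness of the projections; the characteristic function then splits by Pythagoras.
  have h : ∀ v : E, ⟪WithLp.toLp 2 (K.orthogonalProjectionOnto v, U.orthogonalProjectionOnto v), t⟫ =
      ⟪v, ((t.ofLp.1 : E) + t.ofLp.2)⟫ := by
    intro v
    rw [WithLp.prod_inner_apply, inner_add_right]
    simp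
  simp_rw [h]
  rw [← charFun_apply, charFun_stdGaussian, charFun_stdGaussian, charFun_stdGaussian,
    ← Complex.exp_add]
  congr 1
  have h2 : ‖(t.ofLp.1 : E) + t.ofLp.2‖ ^ 2 = ‖t.ofLp.1‖ ^ 2 + ‖t.ofLp.2‖ ^ 2 := by
    rw [norm_add_sq_real, hKU.inner_eq t.ofLp.1.2 t.ofLp.2.2]
    simp
  rw [← Complex.ofReal_pow, h2]
  push_cast
  ring

/-- Bernoulli's inequality with exponent 1/θ. It trades a larger power, paid for in degrees of
freedom, for a smaller multiple of x. -/
lemma one_add_rpow_le {x γ θ : ℝ} (hx : 0 ≤ x) (hγ : 0 ≤ γ) (hθ : 0 < θ) (hθ1 : θ ≤ 1) :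
    (1 + x) ^ γ ≤ (1 + θ * x) ^ (γ / θ) := by
  have h := one_add_mul_self_le_rpow_one_add (s := θ * x) (by nlinarith [mul_nonneg hθ.le hx])
    (p := 1 / θ) (by rw [le_div_iff₀ hθ]; linarith)
  rw [← mul_assoc, one_div_mul_cancel hθ.ne', one_mul] at h
  calc (1 + x) ^ γ ≤ ((1 + θ * x) ^ (1 / θ)) ^ γ := Real.rpow_le_rpow (by positivity) h hγ
    _ = _ := by rw [← Real.rpow_mul (by positivity)]; congr 1; ring

/-- A moment bound for the ratio of the squared norms of two orthogonal projections of a standard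
Gaussian vector. -/
lemma lintegral_rpow_ratio_stdGaussian_le {K U : Submodule ℝ E} (hKU : K ⟂ U)
    {l γ θ c η : ℝ} (hl : 0 ≤ l) (hγ : 0 ≤ γ) (hθ : 0 < θ) (hθ1 : θ ≤ 1) (hc : 0 ≤ c)
    (hη : 0 ≤ η) (hcθ : θ * c < 1) (hd : 2 * (γ / θ) + 2 ≤ finrank ℝ K) :
    ∫⁻ v, ENNReal.ofReal ((1 + (c * ‖U.orthogonalProjectionOnto v‖ ^ 2 + η) /
        (l + ‖K.orthogonalProjectionOnto v‖ ^ 2)) ^ γ) ∂stdGaussian E ≤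
      ENNReal.ofReal (Real.exp (θ * η / 2) * (1 - θ * c) ^ (-(finrank ℝ U / 2 : ℝ))) := by
  have h1 : ∫⁻ v, ENNReal.ofReal ((1 + (c * ‖U.orthogonalProjectionOnto v‖ ^ 2 + η) /
        (l + ‖K.orthogonalProjectionOnto v‖ ^ 2)) ^ γ) ∂stdGaussian E =
      ∫⁻ w, ENNReal.ofReal ((1 + (c * ‖w.2‖ ^ 2 + η) /
        (l + ‖w.1‖ ^ 2)) ^ γ) ∂((stdGaussian K).prod (stdGaussian U)) := by
    rw [← map_orthogonalProjection_stdGaussian hKU, lintegral_map (by fun_prop) (by fun_prop)]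
  -- Integrate over `K` first with the `U` component frozen; what remains is a chi-squared
  -- exponential moment.
  rw [h1, lintegral_prod_symm' _ (by fun_prop)]
  calc _ ≤ ∫⁻ w, ENNReal.ofReal (Real.exp (θ * η / 2)) *
        ENNReal.ofReal (Real.exp (θ * c / 2 * ‖w‖ ^ 2)) ∂stdGaussian U := by
        refine lintegral_mono fun w => ?_
        have hu : 0 ≤ θ * (c * ‖w‖ ^ 2 + η) := by positivity
        refine le_trans (lintegral_mono fun v => ?_)
          ((lintegral_rpow_stdGaussian_le (E := K) hu hl (by positivity) hd).trans_eq ?_)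
        · refine ENNReal.ofReal_le_ofReal ?_
          rw [mul_div_assoc]
          exact one_add_rpow_le (by positivity) hγ hθ hθ1
        · rw [← ENNReal.ofReal_mul (by positivity), ← Real.exp_add]
          congr 2
          ring
    _ = _ := by
        rw [lintegral_const_mul' _ _ ENNReal.ofReal_ne_top, lintegral_exp_sq_norm_stdGaussian hcθ,
          ← ENNReal.ofReal_mul (by positivity)]

end Gaussian

/-! ### Gram matrices, eigenvalues and determinants. -/

section Gram

variable {n p : ℕ} {X : Matrix (Fin n) (Fin p) ℝ} {k : Finset (Fin p)}

lemma gram_posDef (hG : IsUnit (gram X k)) : (gram X k).PosDef := by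
  have h : (gram X k).PosSemidef := by
    have := Matrix.posSemidef_conjTranspose_mul_self (design X k)
    rwa [Matrix.conjTranspose_eq_transpose_of_trivial] at this
  exact h.posDef_iff_isUnit.2 hG

lemma gram_diag_pos (hG : IsUnit (gram X k)) (j : k) : 0 < gram X k j j :=
  (gram_posDef hG).diag_pos

lemma gram_diag_nonneg (j : k) : 0 ≤ gram X k j j := by
  simp only [gram, Matrix.mul_apply, Matrix.transpose_apply]
  exact Finset.sum_nonneg fun i _ => mul_self_nonneg _

lemma priorScale_eq (hG : IsUnit (gram X k)) :
    priorScale X k = Matrix.diagonal fun j => (gram X k j j)⁻¹ := by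
  refine Matrix.inv_eq_right_inv ?_
  rw [Matrix.diagonal_mul_diagonal, ← Matrix.diagonal_one]
  congr 1
  funext j
  exact mul_inv_cancel₀ (gram_diag_pos hG j).ne'

lemma inv_priorScale (hG : IsUnit (gram X k)) :
    (priorScale X k)⁻¹ = Matrix.diagonal fun j => gram X k j j := by
  rw [priorScale_eq hG]
  refine Matrix.inv_eq_right_inv ?_
  rw [Matrix.diagonal_mul_diagonal, ← Matrix.diagonal_one]
  congr 1
  funext j
  exact inv_mul_cancel₀ (gram_diag_pos hG j).ne'

variable (X k) in
/-- The posterior precision matrix `X_k'X_k + V_k⁻¹ / τ`, up to the error variance. -/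
def precision (τ : ℝ) : Matrix k k ℝ := gram X k + τ⁻¹ • Matrix.diagonal fun j => gram X k j j

lemma precision_posDef (hG : IsUnit (gram X k)) {τ : ℝ} (hτ : 0 < τ) :
    (precision X k τ).PosDef := by
  refine (gram_posDef hG).add_posSemidef (Matrix.PosSemidef.smul ?_ (inv_nonneg.2 hτ.le))
  exact Matrix.PosSemidef.diagonal fun j => gram_diag_nonneg j

lemma postScale_eq (hG : IsUnit (gram X k)) (τ : ℝ) :
    postScale X k τ = (precision X k τ)⁻¹ := by
  rw [postScale, inv_priorScale hG, precision]

lemma isUnit_det_precision (hG : IsUnit (gram X k)) {τ : ℝ} (hτ : 0 < τ) :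
    IsUnit (precision X k τ).det :=
  (precision_posDef hG hτ).det_pos.ne'.isUnit

variable (X k) in
/-- The Gram matrix of the normalised columns of the design matrix. -/
def normGram : Matrix k k ℝ :=
  (Matrix.diagonal fun j => (√(gram X k j j))⁻¹) * gram X k *
    Matrix.diagonal fun j => (√(gram X k j j))⁻¹

lemma normGram_posDef (hG : IsUnit (gram X k)) : (normGram X k).PosDef := by
  have hD : IsUnit (Matrix.diagonal fun j : k => (√(gram X k j j))⁻¹) := by
    rw [Matrix.isUnit_diagonal, Pi.isUnit_iff]
    exact fun j => (inv_ne_zero (Real.sqrt_pos.2 (gram_diag_pos hG j)).ne').isUnit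
  have h := (Matrix.IsUnit.posDef_star_left_conjugate_iff (x := gram X k) hD).2 (gram_posDef hG)
  rwa [Matrix.star_eq_conjTranspose, Matrix.diagonal_conjTranspose, star_trivial] at h

/-- Cyclic invariance of the characteristic polynomial moves the spectrum of the non-symmetric
product to a symmetric matrix, where the spectral theorem applies. -/
lemma charpoly_scaled_gram (hG : IsUnit (gram X k)) :
    (priorScale X k * gram X k).charpoly = (normGram X k).charpoly := by
  rw [normGram, Matrix.charpoly_mul_comm (_ * gram X k), ← mul_assoc,
    Matrix.diagonal_mul_diagonal, priorScale_eq hG]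
  congr 3
  funext j
  rw [← mul_inv, Real.mul_self_sqrt (gram_diag_nonneg j)]

lemma eigs_eq (hG : IsUnit (gram X k)) :
    eigs X k = Finset.univ.val.map (normGram_posDef hG).isHermitian.eigenvalues := by
  rw [eigs, charpoly_scaled_gram hG, Matrix.IsHermitian.roots_charpoly_eq_eigenvalues
    (normGram_posDef hG).isHermitian]
  rfl

lemma setOf_eigs (hG : IsUnit (gram X k)) :
    {ρ | ρ ∈ eigs X k} = Set.range (normGram_posDef hG).isHermitian.eigenvalues := by
  ext ρ
  simp only [eigs_eq hG, Multiset.mem_map, Set.mem_ofPred_eq, Set.mem_range, Finset.mem_val,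
    Finset.mem_univ, true_and]

lemma minEig_le (hG : IsUnit (gram X k)) {ρ : ℝ} (h : ρ ∈ eigs X k) : minEig X k ≤ ρ := by
  refine csInf_le ?_ h
  rw [setOf_eigs hG]
  exact (Set.finite_range _).bddBelow

lemma minEig_pos (hG : IsUnit (gram X k)) (hk : k.Nonempty) : 0 < minEig X k := by
  have : Nonempty k := hk.to_subtype
  have h : minEig X k ∈ {ρ | ρ ∈ eigs X k} := by
    rw [minEig, setOf_eigs hG]
    exact (Set.range_nonempty _).csInf_mem (Set.finite_range _)
  rw [setOf_eigs hG] at h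
  obtain ⟨i, hi⟩ := h
  rw [← hi]
  exact (normGram_posDef hG).eigenvalues_pos i

lemma normGram_sub_posSemidef (hG : IsUnit (gram X k)) :
    (normGram X k - minEig X k • (1 : Matrix k k ℝ)).PosSemidef := by
  have hH := (normGram_posDef hG).isHermitian
  have h1 : (normGram X k - minEig X k • (1 : Matrix k k ℝ)).IsHermitian :=
    hH.sub (by simp [Matrix.IsHermitian])
  rw [h1.posSemidef_iff_eigenvalues_nonneg]
  intro i
  -- Subtracting a scalar matrix shifts the spectrum.
  have hroot : h1.eigenvalues i + minEig X k ∈ eigs X k := by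
    have h2 : h1.eigenvalues i ∈
        (normGram X k - minEig X k • (1 : Matrix k k ℝ)).charpoly.roots := by
      rw [h1.roots_charpoly_eq_eigenvalues]
      exact Multiset.mem_map_of_mem _ (Finset.mem_univ i)
    rw [eigs, charpoly_scaled_gram hG, Polynomial.mem_roots (Matrix.charpoly_monic _).ne_zero,
      Polynomial.IsRoot, Matrix.eval_charpoly]
    rw [Polynomial.mem_roots (Matrix.charpoly_monic _).ne_zero,
      Polynomial.IsRoot, Matrix.eval_charpoly] at h2
    rw [← h2, map_add]
    congr 1
    have h3 : Matrix.scalar k (minEig X k) = minEig X k • (1 : Matrix k k ℝ) := by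
      rw [Matrix.scalar_apply, Matrix.smul_one_eq_diagonal]
    rw [h3]
    abel
  simpa using minEig_le hG hroot

lemma dotProduct_gram_mulVec (θ : k → ℝ) :
    θ ⬝ᵥ (gram X k *ᵥ θ) = (design X k *ᵥ θ) ⬝ᵥ (design X k *ᵥ θ) := by
  rw [gram, ← Matrix.mulVec_mulVec, Matrix.dotProduct_mulVec, Matrix.vecMul_transpose]

/-- The smallest eigenvalue bounds the prior quadratic form by that of the Gram matrix. -/
lemma minEig_mul_sum_le (hG : IsUnit (gram X k)) (θ : k → ℝ) :
    minEig X k * ∑ j, gram X k j j * θ j ^ 2 ≤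
      (design X k *ᵥ θ) ⬝ᵥ (design X k *ᵥ θ) := by
  -- The test vector undoes the column normalisation.
  have h := (normGram_sub_posSemidef hG).dotProduct_mulVec_nonneg
    (fun j => √(gram X k j j) * θ j)
  have h1 : (Matrix.diagonal fun j : k => (√(gram X k j j))⁻¹) *ᵥ
      (fun j => √(gram X k j j) * θ j) = θ := by
    funext j
    have := (Real.sqrt_pos.2 (gram_diag_pos hG j)).ne'
    rw [Matrix.mulVec_diagonal]
    field_simp
  have h2 : (fun j => √(gram X k j j) * θ j) ᵥ*
      (Matrix.diagonal fun j : k => (√(gram X k j j))⁻¹) = θ := by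
    funext j
    have := (Real.sqrt_pos.2 (gram_diag_pos hG j)).ne'
    rw [Matrix.vecMul_diagonal]
    field_simp
  rw [star_trivial, Matrix.sub_mulVec, dotProduct_sub, normGram, ← Matrix.mulVec_mulVec, h1,
    ← Matrix.mulVec_mulVec, Matrix.dotProduct_mulVec _ (Matrix.diagonal _), h2,
    dotProduct_gram_mulVec, Matrix.smul_mulVec, Matrix.one_mulVec, dotProduct_smul, smul_eq_mul,
    sub_nonneg] at h
  refine le_trans (le_of_eq ?_) h
  congr 1
  refine Finset.sum_congr rfl fun j _ => ?_
  rw [mul_mul_mul_comm, Real.mul_self_sqrt (gram_diag_nonneg j), sq]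

/-- Up to the factor (-τ)^{p_k}, the determinant is the characteristic polynomial evaluated at -1/τ.
-/
lemma det_one_add_eq (hG : IsUnit (gram X k)) {τ : ℝ} (hτ : 0 < τ) :
    (1 + τ • (priorScale X k * gram X k)).det =
      ∏ i, (τ * (normGram_posDef hG).isHermitian.eigenvalues i + 1) := by
  have h1 : 1 + τ • (priorScale X k * gram X k) =
      (-τ) • (Matrix.scalar k (-τ⁻¹) - priorScale X k * gram X k) := by
    rw [smul_sub, Matrix.scalar_apply, ← Matrix.smul_one_eq_diagonal, smul_smul, neg_mul_neg,
      mul_inv_cancel₀ hτ.ne', one_smul, neg_smul, sub_neg_eq_add]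
  rw [h1, Matrix.det_smul, ← Matrix.eval_charpoly, charpoly_scaled_gram hG,
    (normGram_posDef hG).isHermitian.charpoly_eq, Polynomial.eval_prod, ← Finset.card_univ,
    ← Finset.prod_const, ← Finset.prod_mul_distrib]
  refine Finset.prod_congr rfl fun i _ => ?_
  simp only [Polynomial.eval_sub, Polynomial.eval_X, Polynomial.eval_C, RCLike.ofReal_real_eq_id,
    id]
  field_simp
  ring

lemma eigProd_pos (hG : IsUnit (gram X k)) {τ : ℝ} (hτ : 0 < τ) : 0 < eigProd X k τ := by
  rw [eigProd, eigs_eq hG, Multiset.map_map]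
  refine Finset.prod_pos fun i _ => ?_
  have := (normGram_posDef hG).eigenvalues_pos i
  simp only [Function.comp]
  positivity

/-- From 1 + τVG = τV · `precision`. This is the form in which the prior and posterior normalising
constants produce the eigenvalue product. -/
lemma eigProd_eq_sqrt (hG : IsUnit (gram X k)) {τ : ℝ} (hτ : 0 < τ) :
    eigProd X k τ =
      √(τ ^ Fintype.card k * (precision X k τ).det * (∏ j, gram X k j j)⁻¹) := by
  have h1 : τ ^ Fintype.card k * (precision X k τ).det * (∏ j, gram X k j j)⁻¹ =
      (1 + τ • (priorScale X k * gram X k)).det := by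
    have h2 : 1 + τ • (priorScale X k * gram X k) =
        τ • (priorScale X k * precision X k τ) := by
      have h3 : priorScale X k * Matrix.diagonal (fun j => gram X k j j) = 1 := by
        rw [priorScale_eq hG, Matrix.diagonal_mul_diagonal, ← Matrix.diagonal_one]
        congr 1
        funext j
        exact inv_mul_cancel₀ (gram_diag_pos hG j).ne'
      rw [precision, mul_add, Matrix.mul_smul, h3, smul_add, smul_smul, mul_inv_cancel₀ hτ.ne',
        one_smul, add_comm]
    rw [h2, Matrix.det_smul, Matrix.det_mul, priorScale_eq hG, Matrix.det_diagonal,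
      Finset.prod_inv_distrib]
    ring
  rw [h1, det_one_add_eq hG hτ, eigProd, eigs_eq hG, Multiset.map_map, Real.sqrt_eq_rpow,
    ← Real.finsetProd_rpow]
  · rfl
  · intro i _
    have := (normGram_posDef hG).eigenvalues_pos i
    positivity

end Gram

/-! ### Conjugate factorisation of the marginal likelihood. -/

section MarginalLikelihood

lemma normalPDF_smul {ι : Type*} [Fintype ι] [DecidableEq ι] (μ x : ι → ℝ) {S T : Matrix ι ι ℝ}
    (hST : S * T = 1) {φ : ℝ} (hφ : 0 < φ) :
    normalPDF μ (φ • S) x = Real.exp (-((x - μ) ⬝ᵥ (T *ᵥ (x - μ))) / (2 * φ)) /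
      √((2 * Real.pi * φ) ^ Fintype.card ι * S.det) := by
  have h1 : (φ • S)⁻¹ = φ⁻¹ • T := by
    refine Matrix.inv_eq_right_inv ?_
    rw [Matrix.smul_mul, Matrix.mul_smul, smul_smul, mul_inv_cancel₀ hφ.ne', one_smul, hST]
  rw [normalPDF, h1, Matrix.det_smul, Matrix.smul_mulVec, dotProduct_smul, smul_eq_mul,
    mul_pow (2 * Real.pi) φ, mul_assoc _ (φ ^ _)]
  congr 2
  field_simp

lemma normalPDF_nonneg {ι : Type*} [Fintype ι] [DecidableEq ι] (μ x : ι → ℝ) (S : Matrix ι ι ℝ) :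
    0 ≤ normalPDF μ S x := by
  unfold normalPDF; positivity

lemma invGammaPDF_nonneg {a b φ : ℝ} (ha : 0 < a) (hb : 0 ≤ b) (hφ : 0 ≤ φ) :
    0 ≤ invGammaPDF a b φ := by
  have := Real.Gamma_pos_of_pos ha
  unfold invGammaPDF; positivity

variable {n p : ℕ} {X : Matrix (Fin n) (Fin p) ℝ} {k : Finset (Fin p)}

lemma penalty_nonneg {τ φ : ℝ} (hτ : 0 < τ) (hφ : 0 < φ) (θ : k → ℝ) :
    0 ≤ penalty X k τ φ θ := by
  refine Finset.prod_nonneg fun j _ => ?_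
  have := gram_diag_nonneg (X := X) j
  positivity

lemma marginalLik_nonneg {τ a l : ℝ} (hτ : 0 < τ) (ha : 0 < a) (hl : 0 < l) (y : Fin n → ℝ) :
    0 ≤ marginalLik X k τ a l y := by
  refine setIntegral_nonneg measurableSet_Ioi fun φ hφ => integral_nonneg fun θ => ?_
  have hφ' : 0 < φ := hφ
  exact mul_nonneg (mul_nonneg (normalPDF_nonneg _ _ _)
    (mul_nonneg (normalPDF_nonneg _ _ _) (penalty_nonneg hτ hφ' θ)))
    (invGammaPDF_nonneg (by positivity) (by positivity) hφ'.le)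

lemma dotProduct_diagonal_mulVec {ι : Type*} [Fintype ι] [DecidableEq ι] (d θ : ι → ℝ) :
    θ ⬝ᵥ (Matrix.diagonal d *ᵥ θ) = ∑ j, d j * θ j ^ 2 := by
  refine Finset.sum_congr rfl fun j _ => ?_
  rw [Matrix.mulVec_diagonal]
  ring

lemma dotProduct_precision_mulVec (τ : ℝ) (θ : k → ℝ) :
    θ ⬝ᵥ (precision X k τ *ᵥ θ) = (design X k *ᵥ θ) ⬝ᵥ (design X k *ᵥ θ) +
      τ⁻¹ * ∑ j, gram X k j j * θ j ^ 2 := by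
  rw [precision, Matrix.add_mulVec, dotProduct_add, dotProduct_gram_mulVec, Matrix.smul_mulVec,
    dotProduct_smul, dotProduct_diagonal_mulVec, smul_eq_mul]

variable (X k) in
/-- The penalised residual sum of squares. -/
def ridgeLoss (τ : ℝ) (y : Fin n → ℝ) (θ : k → ℝ) : ℝ :=
  (y - design X k *ᵥ θ) ⬝ᵥ (y - design X k *ᵥ θ) + τ⁻¹ * ∑ j, gram X k j j * θ j ^ 2

lemma precision_mulVec_postMean (hG : IsUnit (gram X k)) {τ : ℝ} (hτ : 0 < τ) (y : Fin n → ℝ) :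
    precision X k τ *ᵥ postMean X k τ y = (design X k)ᵀ *ᵥ y := by
  rw [postMean, postScale_eq hG, Matrix.mulVec_mulVec,
    Matrix.mul_nonsing_inv _ (isUnit_det_precision hG hτ), Matrix.one_mulVec]

/-- Completing the square. It exhibits `postMean` as the minimiser of the ridge loss, the source of
all comparisons between nested models. -/
lemma ridgeLoss_eq (hG : IsUnit (gram X k)) {τ : ℝ} (hτ : 0 < τ) (l : ℝ) (y : Fin n → ℝ)
    (θ : k → ℝ) :
    l + ridgeLoss X k τ y θ = postSS X k τ l y + (θ - postMean X k τ y) ⬝ᵥ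
      (precision X k τ *ᵥ (θ - postMean X k τ y)) := by
  have h1 := precision_mulVec_postMean hG hτ y
  have hsymm : postMean X k τ y ⬝ᵥ (precision X k τ *ᵥ θ) = θ ⬝ᵥ ((design X k)ᵀ *ᵥ y) := by
    have hT : (precision X k τ)ᵀ = precision X k τ := by
      have := (precision_posDef hG hτ).isHermitian.eq
      rwa [Matrix.conjTranspose_eq_transpose_of_trivial] at this
    rw [Matrix.dotProduct_mulVec, ← Matrix.mulVec_transpose, hT, h1, dotProduct_comm]
  have h2 : design X k *ᵥ θ ⬝ᵥ y = θ ⬝ᵥ ((design X k)ᵀ *ᵥ y) := by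
    rw [Matrix.dotProduct_mulVec, Matrix.vecMul_transpose]
  have h3 : ((design X k)ᵀ *ᵥ y) ⬝ᵥ (postScale X k τ *ᵥ ((design X k)ᵀ *ᵥ y)) =
      postMean X k τ y ⬝ᵥ ((design X k)ᵀ *ᵥ y) := by
    rw [dotProduct_comm]; rfl
  rw [Matrix.mulVec_sub, h1]
  simp only [sub_dotProduct, dotProduct_sub]
  rw [hsymm, dotProduct_precision_mulVec, ridgeLoss, postSS, h3]
  simp only [sub_dotProduct, dotProduct_sub]
  rw [dotProduct_comm y (design X k *ᵥ θ), h2]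
  ring

lemma ridgeLoss_nonneg {τ : ℝ} (hτ : 0 < τ) (y : Fin n → ℝ) (θ : k → ℝ) :
    0 ≤ ridgeLoss X k τ y θ := by
  refine add_nonneg (Finset.sum_nonneg fun i _ => mul_self_nonneg _)
    (mul_nonneg (inv_nonneg.2 hτ.le) (Finset.sum_nonneg fun j _ => ?_))
  exact mul_nonneg (gram_diag_nonneg j) (sq_nonneg _)

lemma postSS_eq_ridgeLoss (hG : IsUnit (gram X k)) {τ : ℝ} (hτ : 0 < τ) (l : ℝ) (y : Fin n → ℝ) :
    postSS X k τ l y = l + ridgeLoss X k τ y (postMean X k τ y) := by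
  rw [ridgeLoss_eq hG hτ]
  simp

lemma postSS_le (hG : IsUnit (gram X k)) {τ : ℝ} (hτ : 0 < τ) (l : ℝ) (y : Fin n → ℝ)
    (θ : k → ℝ) : postSS X k τ l y ≤ l + ridgeLoss X k τ y θ := by
  rw [ridgeLoss_eq hG hτ, le_add_iff_nonneg_right]
  simpa using (precision_posDef hG hτ).posSemidef.dotProduct_mulVec_nonneg
    (θ - postMean X k τ y)

lemma postSS_pos (hG : IsUnit (gram X k)) {τ l : ℝ} (hτ : 0 < τ) (hl : 0 < l) (y : Fin n → ℝ) :
    0 < postSS X k τ l y := by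
  rw [postSS_eq_ridgeLoss hG hτ]
  exact add_pos_of_pos_of_nonneg hl (ridgeLoss_nonneg hτ _ _)

lemma normalPDF_postMean (hG : IsUnit (gram X k)) {τ φ : ℝ} (hτ : 0 < τ) (hφ : 0 < φ)
    (y : Fin n → ℝ) (θ : k → ℝ) :
    normalPDF (postMean X k τ y) (φ • postScale X k τ) θ =
      Real.exp (-((θ - postMean X k τ y) ⬝ᵥ (precision X k τ *ᵥ (θ - postMean X k τ y))) /
        (2 * φ)) / √((2 * Real.pi * φ) ^ Fintype.card k * (precision X k τ).det⁻¹) := by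
  rw [postScale_eq hG, normalPDF_smul _ _
    (Matrix.nonsing_inv_mul _ (isUnit_det_precision hG hτ)) hφ, Matrix.det_nonsing_inv,
    Ring.inverse_eq_inv']

/-- The factor of the marginal likelihood that does not depend on the model. -/
def likConst (n : ℕ) (a l : ℝ) : ℝ :=
  (2 * Real.pi) ^ (-(n / 2 : ℝ)) * ((l / 2) ^ (a / 2) / Real.Gamma (a / 2)) *
    Real.Gamma ((a + n) / 2)

lemma likConst_pos (n : ℕ) {a l : ℝ} (ha : 0 < a) (hl : 0 < l) : 0 < likConst n a l := by
  have h1 := Real.Gamma_pos_of_pos (show 0 < a / 2 by positivity)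
  have h2 := Real.Gamma_pos_of_pos (show 0 < (a + n) / 2 by positivity)
  unfold likConst; positivity

/-- Normal-inverse-gamma conjugacy, pointwise in (θ, φ), with the penalty carried along untouched.
-/
lemma likelihood_mul_prior (hG : IsUnit (gram X k)) {τ φ a l : ℝ} (hτ : 0 < τ) (hφ : 0 < φ)
    (ha : 0 < a) (hl : 0 < l) (y : Fin n → ℝ) (θ : k → ℝ) :
    normalPDF (design X k *ᵥ θ) (φ • (1 : Matrix (Fin n) (Fin n) ℝ)) y *
      pMOM X k τ φ θ * invGammaPDF (a / 2) (l / 2) φ =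
    (likConst n a l * (postSS X k τ l y / 2) ^ (-((a + n) / 2)) / eigProd X k τ) *
      (normalPDF (postMean X k τ y) (φ • postScale X k τ) θ *
        invGammaPDF ((a + n) / 2) (postSS X k τ l y / 2) φ * penalty X k τ φ θ) := by
  have hs : 0 < postSS X k τ l y := postSS_pos hG hτ hl y
  have hA : 0 < (precision X k τ).det := (precision_posDef hG hτ).det_pos
  have hg : 0 < ∏ j, gram X k j j := Finset.prod_pos fun j _ => gram_diag_pos hG j
  have hV : priorScale X k * Matrix.diagonal (fun j => gram X k j j) = 1 := by
    rw [priorScale_eq hG, Matrix.diagonal_mul_diagonal, ← Matrix.diagonal_one]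
    congr 1
    funext j
    exact inv_mul_cancel₀ (gram_diag_pos hG j).ne'
  have hVdet : (priorScale X k).det = (∏ j, gram X k j j)⁻¹ := by
    rw [priorScale_eq hG, Matrix.det_diagonal, Finset.prod_inv_distrib]
  -- The prior and posterior normal constants differ exactly by the eigenvalue product.
  have h3 : √((2 * Real.pi * (τ * φ)) ^ Fintype.card k * (∏ j, gram X k j j)⁻¹) =
      √((2 * Real.pi * φ) ^ Fintype.card k * (precision X k τ).det⁻¹) * eigProd X k τ := by
    rw [eigProd_eq_sqrt hG hτ, ← Real.sqrt_mul (by positivity)]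
    congr 1
    simp only [mul_pow]
    field_simp
  have h4 : √((2 * Real.pi * φ) ^ Fintype.card (Fin n)) =
      (2 * Real.pi) ^ (n / 2 : ℝ) * φ ^ (n / 2 : ℝ) := by
    rw [Fintype.card_fin, Real.sqrt_eq_rpow, ← Real.rpow_natCast, ← Real.rpow_mul (by positivity),
      Real.mul_rpow (by positivity) hφ.le]
    congr 2 <;> ring
  have h5 : φ ^ (-((a + n) / 2) - 1) * φ ^ (n / 2 : ℝ) = φ ^ (-(a / 2) - 1) := by
    rw [← Real.rpow_add hφ]
    congr 1
    ring
  have h6 : (postSS X k τ l y / 2) ^ (-((a + n) / 2)) * (postSS X k τ l y / 2) ^ ((a + n) / 2) =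
      1 := by
    rw [← Real.rpow_add (by positivity)]
    simp
  have h7 : (2 * Real.pi) ^ (-(n / 2 : ℝ)) * (2 * Real.pi) ^ (n / 2 : ℝ) = 1 := by
    rw [← Real.rpow_add (by positivity)]
    simp
  have hexp : Real.exp (-((y - design X k *ᵥ θ) ⬝ᵥ (y - design X k *ᵥ θ)) / (2 * φ)) *
      Real.exp (-(∑ j, gram X k j j * θ j ^ 2) / (2 * (τ * φ))) * Real.exp (-(l / 2) / φ) =
      Real.exp (-((θ - postMean X k τ y) ⬝ᵥ (precision X k τ *ᵥ (θ - postMean X k τ y))) /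
        (2 * φ)) * Real.exp (-(postSS X k τ l y / 2) / φ) := by
    rw [← Real.exp_add, ← Real.exp_add, ← Real.exp_add]
    congr 1
    have := ridgeLoss_eq hG hτ l y θ
    rw [ridgeLoss] at this
    have h8 : (θ - postMean X k τ y) ⬝ᵥ (precision X k τ *ᵥ (θ - postMean X k τ y)) =
      l + ((y - design X k *ᵥ θ) ⬝ᵥ (y - design X k *ᵥ θ) +
        τ⁻¹ * ∑ j, gram X k j j * θ j ^ 2) - postSS X k τ l y := by linarith
    rw [h8]
    field_simp
    ring
  have hΓ1 := Real.Gamma_pos_of_pos (show 0 < a / 2 by positivity)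
  have hΓ2 := Real.Gamma_pos_of_pos (show 0 < (a + n) / 2 by positivity)
  have he := eigProd_pos hG hτ
  have hsq : 0 < √((2 * Real.pi * φ) ^ Fintype.card k * (precision X k τ).det⁻¹) := by positivity
  rw [normalPDF_postMean hG hτ hφ, normalPDF_smul _ _ (T := 1) (by simp) hφ, pMOM,
    normalPDF_smul _ _ hV (by positivity), hVdet, h3, Matrix.det_one, mul_one, h4,
    Matrix.one_mulVec, sub_zero, dotProduct_diagonal_mulVec, invGammaPDF, invGammaPDF, ← h5,
    likConst]
  set e1 := Real.exp (-((y - design X k *ᵥ θ) ⬝ᵥ (y - design X k *ᵥ θ)) / (2 * φ))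
  set e2 := Real.exp (-(∑ j, gram X k j j * θ j ^ 2) / (2 * (τ * φ)))
  set e3 := Real.exp (-(l / 2) / φ)
  set e4 := Real.exp (-((θ - postMean X k τ y) ⬝ᵥ (precision X k τ *ᵥ (θ - postMean X k τ y))) /
        (2 * φ))
  set e5 := Real.exp (-(postSS X k τ l y / 2) / φ)
  set Q := √((2 * Real.pi * φ) ^ Fintype.card k * (precision X k τ).det⁻¹)
  set s1 := (postSS X k τ l y / 2) ^ (-((a + n) / 2))
  set s2 := (postSS X k τ l y / 2) ^ ((a + n) / 2)
  set c1 := (2 * Real.pi) ^ (-(n / 2 : ℝ))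
  have hc2 : 0 < (2 * Real.pi) ^ (n / 2 : ℝ) := by positivity
  set c2 := (2 * Real.pi) ^ (n / 2 : ℝ)
  have hf : 0 < φ ^ (n / 2 : ℝ) := by positivity
  set f := φ ^ (n / 2 : ℝ)
  set f2 := φ ^ (-((a + n) / 2) - 1)
  have hc1 : c1 = c2⁻¹ := eq_inv_of_mul_eq_one_left h7
  set Γ1 := Real.Gamma (a / 2)
  set Γ2 := Real.Gamma ((a + n) / 2)
  set L := (l / 2) ^ (a / 2)
  set E := eigProd X k τ
  set pen := penalty X k τ φ θ
  calc e1 / (c2 * f) * (e2 / (Q * E) * pen) * (L / Γ1 * (f2 * f) * e3)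
      = (e1 * e2 * e3) * (c2⁻¹ * (f / f) * pen * L / Γ1 * f2 / (Q * E)) := by
        field_simp
    _ = (e4 * e5) * (c2⁻¹ * 1 * pen * L / Γ1 * f2 / (Q * E)) := by rw [hexp, div_self hf.ne']
    _ = (e4 * e5) * (c1 * (s1 * s2) * pen * L / Γ1 * f2 / (Q * E)) * (Γ2 / Γ2) := by
        rw [h6, hc1, div_self hΓ2.ne', mul_one, mul_one]
    _ = _ := by ring

/-- The marginal likelihood factors through the posterior expected penalty. -/
lemma marginalLik_eq (hG : IsUnit (gram X k)) {τ a l : ℝ} (hτ : 0 < τ)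
    (ha : 0 < a) (hl : 0 < l) (y : Fin n → ℝ) :
    marginalLik X k τ a l y =
      (likConst n a l * (postSS X k τ l y / 2) ^ (-((a + n) / 2)) / eigProd X k τ) *
        postPenalty X k τ a l y := by
  rw [marginalLik, postPenalty, ← integral_const_mul]
  refine setIntegral_congr_fun measurableSet_Ioi fun φ hφ => ?_
  rw [← integral_const_mul]
  exact integral_congr_ae (ae_of_all _ fun θ => likelihood_mul_prior hG hτ hφ ha hl y θ)

end MarginalLikelihood

/-! ### Integrability and positivity of the posterior expected penalty. -/

section Positivity

/-- The inversion φ ↦ 1/φ turns this into a gamma integral. -/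
lemma integrableOn_rpow_mul_exp_neg_div {a b : ℝ} (ha : 0 < a) (hb : 0 < b) :
    IntegrableOn (fun φ : ℝ => φ ^ (-a - 1) * Real.exp (-b / φ)) (Set.Ioi 0) := by
  have h : IntegrableOn (fun x : ℝ => x ^ (a - 1) * Real.exp (-b * x)) (Set.Ioi 0) := by
    have := integrableOn_rpow_mul_exp_neg_mul_rpow (s := a - 1) (p := 1) (by linarith)
      one_pos hb
    simpa using this
  rw [← integrableOn_Ioi_comp_rpow_iff _ (show (-1 : ℝ) ≠ 0 by norm_num)] at h
  refine h.congr_fun (fun φ hφ => ?_) measurableSet_Ioi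
  have hφ' : (0 : ℝ) < φ := hφ
  simp only [smul_eq_mul, abs_neg, abs_one, one_mul]
  rw [← Real.rpow_mul hφ'.le, ← mul_assoc, ← Real.rpow_add hφ', Real.rpow_neg_one, ← div_eq_mul_inv]
  congr 2
  ring

lemma gaussian_eq_translate (w m : ℝ) :
    (fun x : ℝ => Real.exp (-w * (x - m) ^ 2)) =
      fun x => (fun x => Real.exp (-w * x ^ 2)) (x - m) := rfl

lemma integrable_gaussian_translate {w : ℝ} (hw : 0 < w) (m : ℝ) :
    Integrable fun x : ℝ => Real.exp (-w * (x - m) ^ 2) := by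
  rw [gaussian_eq_translate]
  exact (integrable_exp_neg_mul_sq hw).comp_sub_right m

lemma integral_gaussian_translate (w m : ℝ) :
    ∫ x : ℝ, Real.exp (-w * (x - m) ^ 2) = √(Real.pi / w) := by
  rw [gaussian_eq_translate, integral_sub_right_eq_self (fun x => Real.exp (-w * x ^ 2)),
    integral_gaussian]

lemma integrable_gaussian_pi {ι : Type*} [Fintype ι] {w : ι → ℝ} (hw : ∀ j, 0 < w j)
    (m : ι → ℝ) : Integrable fun θ : ι → ℝ => ∏ j, Real.exp (-w j * (θ j - m j) ^ 2) :=
  Integrable.fintype_prod (f := fun j x => Real.exp (-w j * (x - m j) ^ 2))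
    fun j => integrable_gaussian_translate (hw j) (m j)

lemma integral_gaussian_pi {ι : Type*} [Fintype ι] (w m : ι → ℝ) :
    ∫ θ : ι → ℝ, ∏ j, Real.exp (-w j * (θ j - m j) ^ 2) = ∏ j, √(Real.pi / w j) := by
  rw [integral_fintype_prod_volume_eq_prod (f := fun j x => Real.exp (-w j * (x - m j) ^ 2))]
  exact Finset.prod_congr rfl fun j _ => integral_gaussian_translate _ _

/-- Integrability of a normal-inverse-gamma type kernel. -/
lemma integrable_normal_invGamma {ι : Type*} [Fintype ι] {w : ι → ℝ} (hw : ∀ j, 0 < w j)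
    (m : ι → ℝ) {a b : ℝ} (ha : 0 < a) (hb : 0 < b) :
    Integrable (fun z : ℝ × (ι → ℝ) => z.1 ^ (-a - 1 - Fintype.card ι / 2) * Real.exp (-b / z.1) *
      ∏ j, Real.exp (-(w j / z.1) * (z.2 j - m j) ^ 2))
      ((volume.restrict (Set.Ioi 0)).prod volume) := by
  rw [integrable_prod_iff (by fun_prop)]
  constructor
  · refine (ae_restrict_mem measurableSet_Ioi).mono fun φ hφ => ?_
    exact (integrable_gaussian_pi (fun j => div_pos (hw j) hφ) m).const_mul
      (φ ^ (-a - 1 - Fintype.card ι / 2) * Real.exp (-b / φ))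
  · have h := (integrableOn_rpow_mul_exp_neg_div ha hb).mul_const (∏ j, √(Real.pi / w j))
    refine IntegrableOn.congr_fun h (fun φ hφ => ?_) measurableSet_Ioi
    have hφ' : (0 : ℝ) < φ := hφ
    have h1 : ∀ θ : ι → ℝ, ‖φ ^ (-a - 1 - Fintype.card ι / 2) * Real.exp (-b / φ) *
        ∏ j, Real.exp (-(w j / φ) * (θ j - m j) ^ 2)‖ =
        φ ^ (-a - 1 - Fintype.card ι / 2) * Real.exp (-b / φ) *
        ∏ j, Real.exp (-(w j / φ) * (θ j - m j) ^ 2) := fun θ => by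
      rw [Real.norm_of_nonneg]
      exact mul_nonneg (by positivity) (Finset.prod_nonneg fun j _ => (Real.exp_pos _).le)
    simp only [h1]
    rw [integral_const_mul, integral_gaussian_pi]
    -- Each coordinate contributes √φ, cancelling the extra exponent `Fintype.card ι / 2`.
    have h2 : ∏ j, √(Real.pi / (w j / φ)) = φ ^ (Fintype.card ι / 2 : ℝ) *
        ∏ j, √(Real.pi / w j) := by
      have h3 : ∀ j, √(Real.pi / (w j / φ)) = √φ * √(Real.pi / w j) := fun j => by
        rw [← Real.sqrt_mul hφ'.le]
        congr 1
        field_simp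
      simp_rw [h3]
      rw [Finset.prod_mul_distrib, Finset.prod_const, Finset.card_univ, Real.sqrt_eq_rpow,
        ← Real.rpow_natCast, ← Real.rpow_mul hφ'.le]
      congr 2
      ring
    have h4 : φ ^ (-a - 1 - Fintype.card ι / 2) * φ ^ (Fintype.card ι / 2 : ℝ) =
        φ ^ (-a - 1) := by
      rw [← Real.rpow_add hφ']
      congr 1
      ring
    rw [h2, ← h4]
    ring

/-- Half of the Gaussian exponent is spent on absorbing the quadratic factor, using x² ≤ 2(x-m)² +
2m² and u e^{-u} ≤ 1. -/
lemma sq_mul_exp_le {v x m : ℝ} (hv : 0 ≤ v) :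
    x ^ 2 * v * Real.exp (-(v / 2) * (x - m) ^ 2) ≤
      (8 + 2 * v * m ^ 2) * Real.exp (-(v / 4) * (x - m) ^ 2) := by
  set u := v / 4 * (x - m) ^ 2 with hu
  have hu0 : 0 ≤ u := by positivity
  have h1 : x ^ 2 * v ≤ 8 * u + 2 * v * m ^ 2 := by
    have : 0 ≤ v * (x - 2 * m) ^ 2 := by positivity
    rw [hu]
    nlinarith
  have h2 : u * Real.exp (-u) ≤ 1 := by
    rw [Real.exp_neg, ← div_eq_mul_inv, div_le_one (Real.exp_pos _)]
    linarith [Real.add_one_le_exp u]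
  have h3 : Real.exp (-u) ≤ 1 := Real.exp_le_one_iff.2 (by linarith)
  have h4 : Real.exp (-(v / 2) * (x - m) ^ 2) = Real.exp (-u) * Real.exp (-u) := by
    rw [← Real.exp_add]; congr 1; rw [hu]; ring
  have h5 : Real.exp (-(v / 4) * (x - m) ^ 2) = Real.exp (-u) := by
    congr 1; rw [hu]; ring
  rw [h4, h5, ← mul_assoc]
  refine mul_le_mul_of_nonneg_right ?_ (Real.exp_pos _).le
  calc x ^ 2 * v * Real.exp (-u) ≤ (8 * u + 2 * v * m ^ 2) * Real.exp (-u) := by gcongr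
    _ = 8 * (u * Real.exp (-u)) + 2 * v * m ^ 2 * Real.exp (-u) := by ring
    _ ≤ 8 * 1 + 2 * v * m ^ 2 * 1 := by gcongr
    _ = _ := by ring

lemma add_div_le_mul_exp {κ ε φ : ℝ} (hκ : 0 ≤ κ) (hε : 0 < ε) (hφ : 0 < φ) :
    8 + κ / φ ≤ (8 + κ / ε) * Real.exp (ε / φ) := by
  have h1 : 1 ≤ Real.exp (ε / φ) := Real.one_le_exp (by positivity)
  have h2 : ε / φ ≤ Real.exp (ε / φ) := by linarith [Real.add_one_le_exp (ε / φ)]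
  calc 8 + κ / φ = 8 * 1 + κ / ε * (ε / φ) := by field_simp
    _ ≤ 8 * Real.exp (ε / φ) + κ / ε * Real.exp (ε / φ) := by gcongr
    _ = _ := by ring

lemma prod_sq_mul_exp_le {ι : Type*} [Fintype ι] {w : ι → ℝ} (hw : ∀ j, 0 < w j)
    (m : ι → ℝ) {b : ℝ} (hb : 0 < b) :
    ∃ C : ℝ, ∀ φ : ℝ, 0 < φ → ∀ θ : ι → ℝ,
      ∏ j, (θ j ^ 2 * (w j / φ) * Real.exp (-(w j / φ / 2) * (θ j - m j) ^ 2)) ≤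
        C * Real.exp (b / φ) * ∏ j, Real.exp (-(w j / 4 / φ) * (θ j - m j) ^ 2) := by
  -- Each coordinate leaves a factor growing like 1/φ, absorbed by e^{ε/φ}. This `ε` keeps the
  -- product below e^{b/φ}; the `+ 1` covers an empty index type.
  set ε := b / (Fintype.card ι + 1) with hε
  have hε0 : 0 < ε := by positivity
  refine ⟨∏ j, (8 + 2 * w j * m j ^ 2 / ε), fun φ hφ θ => ?_⟩
  have h1 : ∀ j, 0 ≤ 2 * w j * m j ^ 2 := fun j => by have := hw j; positivity
  have hC : 0 ≤ ∏ j, (8 + 2 * w j * m j ^ 2 / ε) :=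
    Finset.prod_nonneg fun j _ => by have := h1 j; positivity
  calc _ ≤ ∏ j, ((8 + 2 * w j * m j ^ 2 / ε) * Real.exp (ε / φ) *
        Real.exp (-(w j / 4 / φ) * (θ j - m j) ^ 2)) := by
        refine Finset.prod_le_prod (fun j _ => ?_) fun j _ => ?_
        · have := hw j
          positivity
        · have hwj := hw j
          refine (sq_mul_exp_le (by positivity)).trans ?_
          have h2 := add_div_le_mul_exp (h1 j) hε0 hφ
          have h3 : 8 + 2 * (w j / φ) * m j ^ 2 = 8 + 2 * w j * m j ^ 2 / φ := by ring
          rw [h3, show w j / φ / 4 = w j / 4 / φ by ring]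
          gcongr
    _ = (∏ j, (8 + 2 * w j * m j ^ 2 / ε)) * Real.exp (ε / φ) ^ Fintype.card ι *
        ∏ j, Real.exp (-(w j / 4 / φ) * (θ j - m j) ^ 2) := by
        rw [Finset.prod_mul_distrib, Finset.prod_mul_distrib, Finset.prod_const, Finset.card_univ]
    _ ≤ _ := by
        have h4 : Real.exp (ε / φ) ^ Fintype.card ι ≤ Real.exp (b / φ) := by
          rw [← Real.exp_nat_mul]
          refine Real.exp_le_exp.2 ?_
          rw [hε]
          have : (Fintype.card ι : ℝ) * (b / (Fintype.card ι + 1) / φ) =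
            b / φ * (Fintype.card ι / (Fintype.card ι + 1)) := by field_simp
          rw [this]
          refine mul_le_of_le_one_right (by positivity) ?_
          rw [div_le_one (by positivity)]
          linarith
        refine mul_le_mul_of_nonneg_right ?_ (Finset.prod_nonneg fun j _ => (Real.exp_pos _).le)
        exact mul_le_mul_of_nonneg_left h4 hC

variable {n p : ℕ} {X : Matrix (Fin n) (Fin p) ℝ} {k : Finset (Fin p)}

/-- The integrand of `postPenalty`, with the normal density written out. -/
lemma postPenalty_integrand (hG : IsUnit (gram X k)) {τ φ a l : ℝ} (hτ : 0 < τ) (hφ : 0 < φ)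
    (y : Fin n → ℝ) (θ : k → ℝ) :
    normalPDF (postMean X k τ y) (φ • postScale X k τ) θ *
      invGammaPDF ((a + n) / 2) (postSS X k τ l y / 2) φ * penalty X k τ φ θ =
    (√((2 * Real.pi) ^ Fintype.card k * (precision X k τ).det⁻¹))⁻¹ *
      ((postSS X k τ l y / 2) ^ ((a + n) / 2) / Real.Gamma ((a + n) / 2)) *
      (φ ^ (-((a + n) / 2) - 1 - Fintype.card k / 2) * Real.exp (-(postSS X k τ l y / 2) / φ)) *
      (Real.exp (-((θ - postMean X k τ y) ⬝ᵥ (precision X k τ *ᵥ (θ - postMean X k τ y))) /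
        (2 * φ)) * ∏ j, (θ j ^ 2 * (gram X k j j / τ / φ))) := by
  have hA : 0 < (precision X k τ).det := (precision_posDef hG hτ).det_pos
  have h1 : √((2 * Real.pi * φ) ^ Fintype.card k * (precision X k τ).det⁻¹) =
      √((2 * Real.pi) ^ Fintype.card k * (precision X k τ).det⁻¹) *
        φ ^ (Fintype.card k / 2 : ℝ) := by
    have h2 : φ ^ (Fintype.card k / 2 : ℝ) = √(φ ^ Fintype.card k) := by
      rw [Real.sqrt_eq_rpow, ← Real.rpow_natCast, ← Real.rpow_mul hφ.le]
      congr 1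
      ring
    rw [h2, ← Real.sqrt_mul (by positivity), mul_pow (2 * Real.pi)]
    congr 1
    ring
  have h3 : penalty X k τ φ θ = ∏ j, (θ j ^ 2 * (gram X k j j / τ / φ)) :=
    Finset.prod_congr rfl fun j _ => by field_simp
  rw [normalPDF_postMean hG hτ hφ, invGammaPDF, h1, h3,
    Real.rpow_sub hφ _ (Fintype.card k / 2 : ℝ)]
  simp only [div_eq_mul_inv, mul_inv]
  ring

/-- Keeping only the diagonal prior part lets a product of univariate Gaussians dominate the
posterior normal. -/
lemma sum_le_dotProduct_precision (τ : ℝ) (θ : k → ℝ) :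
    ∑ j, gram X k j j / τ * θ j ^ 2 ≤ θ ⬝ᵥ (precision X k τ *ᵥ θ) := by
  rw [dotProduct_precision_mulVec, Finset.mul_sum]
  refine le_trans (le_of_eq (Finset.sum_congr rfl fun j _ => by ring))
    (le_add_of_nonneg_left (Finset.sum_nonneg fun i _ => mul_self_nonneg _))

/-- Positivity needs integrability, since a divergent Bochner integral would be 0. It makes division
by E_t and by the marginal likelihood of t legitimate. -/
lemma postPenalty_pos (hG : IsUnit (gram X k)) {τ a l : ℝ} (hτ : 0 < τ) (ha : 0 < a) (hl : 0 < l)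
    (y : Fin n → ℝ) : 0 < postPenalty X k τ a l y := by
  have hs : 0 < postSS X k τ l y := postSS_pos hG hτ hl y
  have hA : 0 < (precision X k τ).det := (precision_posDef hG hτ).det_pos
  have hΓ := Real.Gamma_pos_of_pos (show 0 < (a + n) / 2 by positivity)
  have hw : ∀ j, 0 < gram X k j j / τ := fun j => div_pos (gram_diag_pos hG j) hτ
  set c := (√((2 * Real.pi) ^ Fintype.card k * (precision X k τ).det⁻¹))⁻¹ *
      ((postSS X k τ l y / 2) ^ ((a + n) / 2) / Real.Gamma ((a + n) / 2)) with hc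
  have hc0 : 0 < c := by positivity
  set F : ℝ × (k → ℝ) → ℝ := fun z =>
    c * (z.1 ^ (-((a + n) / 2) - 1 - Fintype.card k / 2) *
      Real.exp (-(postSS X k τ l y / 2) / z.1)) *
      (Real.exp (-((z.2 - postMean X k τ y) ⬝ᵥ (precision X k τ *ᵥ (z.2 - postMean X k τ y))) /
        (2 * z.1)) * ∏ j, (z.2 j ^ 2 * (gram X k j j / τ / z.1))) with hF
  have hrepr : postPenalty X k τ a l y = ∫ φ in Set.Ioi (0 : ℝ), ∫ θ : k → ℝ, F (φ, θ) := by
    refine setIntegral_congr_fun measurableSet_Ioi fun φ hφ => ?_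
    exact integral_congr_ae (ae_of_all _ fun θ => postPenalty_integrand hG hτ hφ y θ)
  set μ := ((volume : Measure ℝ).restrict (Set.Ioi 0)).prod (volume : Measure (k → ℝ)) with hμ
  have hae : ∀ᵐ z ∂μ, 0 < z.1 := by
    have : μ = ((volume : Measure ℝ).prod (volume : Measure (k → ℝ))).restrict
        (Set.Ioi 0 ×ˢ Set.univ) := by
      rw [← Measure.prod_restrict, Measure.restrict_univ]
    rw [this]
    refine (ae_restrict_mem (measurableSet_Ioi.prod MeasurableSet.univ)).mono fun z hz => hz.1
  have hnonneg : ∀ z : ℝ × (k → ℝ), 0 < z.1 → 0 ≤ F z := fun z hz => by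
    have h1 : 0 ≤ ∏ j, (z.2 j ^ 2 * (gram X k j j / τ / z.1)) :=
      Finset.prod_nonneg fun j _ => by have := hw j; positivity
    simp only [hF]
    positivity
  have hmeas : Measurable F := by
    have : Continuous fun θ : k → ℝ =>
        (θ - postMean X k τ y) ⬝ᵥ (precision X k τ *ᵥ (θ - postMean X k τ y)) := by
      fun_prop
    have h2 := this.measurable
    simp only [hF]
    fun_prop
  have hint : Integrable F μ := by
    -- Half of the inverse gamma rate s̃/2 is given up to control the penalty near φ = 0.
    obtain ⟨C, hC⟩ := prod_sq_mul_exp_le hw (postMean X k τ y)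
      (show 0 < postSS X k τ l y / 4 by positivity)
    have h1 := (integrable_normal_invGamma (fun j => div_pos (hw j) (show (0 : ℝ) < 4 by norm_num))
      (postMean X k τ y) (show 0 < (a + n) / 2 by positivity)
      (show 0 < postSS X k τ l y / 4 by positivity)).const_mul (c * C)
    refine h1.mono' hmeas.aestronglyMeasurable (hae.mono fun z hz => ?_)
    rw [Real.norm_of_nonneg (hnonneg z hz)]
    have h2 : Real.exp (-((z.2 - postMean X k τ y) ⬝ᵥ
        (precision X k τ *ᵥ (z.2 - postMean X k τ y))) / (2 * z.1)) ≤
        ∏ j, Real.exp (-(gram X k j j / τ / z.1 / 2) * (z.2 j - postMean X k τ y j) ^ 2) := by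
      rw [← Real.exp_sum]
      refine Real.exp_le_exp.2 ?_
      have h3 := sum_le_dotProduct_precision (X := X) τ (z.2 - postMean X k τ y)
      rw [div_le_iff₀ (by positivity), Finset.sum_mul]
      refine (neg_le_neg h3).trans (le_of_eq ?_)
      rw [← Finset.sum_neg_distrib]
      refine Finset.sum_congr rfl fun j _ => ?_
      simp only [Pi.sub_apply]
      field_simp
    have h4 : 0 ≤ ∏ j, (z.2 j ^ 2 * (gram X k j j / τ / z.1)) :=
      Finset.prod_nonneg fun j _ => by have := hw j; positivity
    have h5 : Real.exp (-(postSS X k τ l y / 2) / z.1) * Real.exp (postSS X k τ l y / 4 / z.1) =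
        Real.exp (-(postSS X k τ l y / 4) / z.1) := by
      rw [← Real.exp_add]
      congr 1
      ring
    calc F z ≤ c * (z.1 ^ (-((a + n) / 2) - 1 - Fintype.card k / 2) *
          Real.exp (-(postSS X k τ l y / 2) / z.1)) *
          (C * Real.exp (postSS X k τ l y / 4 / z.1) * ∏ j, Real.exp
            (-(gram X k j j / τ / 4 / z.1) * (z.2 j - postMean X k τ y j) ^ 2)) := by
          simp only [hF]
          refine mul_le_mul_of_nonneg_left ?_ (by positivity)
          refine le_trans ?_ (hC z.1 hz z.2)
          rw [Finset.prod_mul_distrib (g := fun j => Real.exp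
            (-(gram X k j j / τ / z.1 / 2) * (z.2 j - postMean X k τ y j) ^ 2)), mul_comm]
          exact mul_le_mul_of_nonneg_left h2 h4
      _ = _ := by
          rw [← h5]
          ring
  rw [hrepr, ← integral_prod F hint,
    integral_pos_iff_support_of_nonneg_ae (hae.mono hnonneg) hint]
  -- Any box of positive volume away from the zeros of the penalty will do.
  have hsub : Set.Ioo (1 : ℝ) 2 ×ˢ Set.univ.pi (fun _ : k => Set.Ioo (1 : ℝ) 2) ⊆
      Function.support F := by
    rintro ⟨φ, θ⟩ ⟨hφ, hθ⟩
    have hφ0 : 0 < φ := lt_trans one_pos hφ.1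
    have h1 : 0 < ∏ j, (θ j ^ 2 * (gram X k j j / τ / φ)) :=
      Finset.prod_pos fun j _ => by
        have := hw j
        have hj : 0 < θ j := lt_trans one_pos (hθ j (Set.mem_univ j)).1
        positivity
    refine ne_of_gt ?_
    simp only [hF]
    positivity
  refine lt_of_lt_of_le ?_ (measure_mono hsub)
  rw [hμ, Measure.prod_prod, Measure.restrict_apply measurableSet_Ioo,
    Set.inter_eq_left.2 (Set.Ioo_subset_Ioi_self.trans (Set.Ioi_subset_Ioi zero_le_one)), Real.volume_Ioo, volume_pi_pi]
  simp only [Real.volume_Ioo]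
  norm_num

end Positivity

/-! ### Residual sums of squares of nested models. -/

section Nested

open Module

variable {n p : ℕ} {X : Matrix (Fin n) (Fin p) ℝ} {k t m : Finset (Fin p)}

lemma design_mulVec_eq (c : Fin p → ℝ) (i : Fin n) :
    (design X k *ᵥ fun j : k => c j) i = ∑ j ∈ k, X i j * c j := by
  rw [← Finset.sum_coe_sort k (fun j => X i j * c j)]
  rfl

lemma gram_diag_eq (j : k) : gram X k j j = ∑ i, X i j ^ 2 := by
  simp only [gram, Matrix.mul_apply, Matrix.transpose_apply, sq]
  rfl

lemma design_mulVec_subset (htm : t ⊆ m) {c : Fin p → ℝ} (hc : ∀ j ∈ m, j ∉ t → c j = 0) :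
    design X m *ᵥ (fun j : m => c j) = design X t *ᵥ (fun j : t => c j) := by
  funext i
  rw [design_mulVec_eq, design_mulVec_eq]
  exact (Finset.sum_subset htm fun j hj hjt => by rw [hc j hj hjt, mul_zero]).symm

lemma ridgeLoss_subset (htm : t ⊆ m) {c : Fin p → ℝ} (hc : ∀ j ∈ m, j ∉ t → c j = 0) (τ : ℝ)
    (y : Fin n → ℝ) :
    ridgeLoss X m τ y (fun j : m => c j) = ridgeLoss X t τ y (fun j : t => c j) := by
  have h : ∑ j : m, gram X m j j * c j ^ 2 = ∑ j : t, gram X t j j * c j ^ 2 := by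
    simp_rw [gram_diag_eq]
    rw [Finset.sum_coe_sort m (fun j => (∑ i, X i j ^ 2) * c j ^ 2),
      Finset.sum_coe_sort t (fun j => (∑ i, X i j ^ 2) * c j ^ 2)]
    exact (Finset.sum_subset htm fun j hj hjt => by rw [hc j hj hjt]; ring).symm
  rw [ridgeLoss, ridgeLoss, design_mulVec_subset htm hc, h]

/-- Extension of a coefficient vector by zero. -/
def extend (θ : k → ℝ) (j : Fin p) : ℝ := if h : j ∈ k then θ ⟨j, h⟩ else 0

lemma extend_coe (θ : k → ℝ) : (fun j : k => extend θ j) = θ := by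
  funext j
  simp [extend]

/-- The minimiser for t, extended by zero, is a competitor for m with the same loss. -/
lemma postSS_anti (hGt : IsUnit (gram X t)) (hGm : IsUnit (gram X m)) (htm : t ⊆ m) {τ : ℝ}
    (hτ : 0 < τ) (l : ℝ) (y : Fin n → ℝ) : postSS X m τ l y ≤ postSS X t τ l y := by
  rw [postSS_eq_ridgeLoss hGt hτ, ← extend_coe (postMean X t τ y),
    ← ridgeLoss_subset (m := m) htm fun j _ hj => by simp [extend, hj]]
  exact postSS_le hGm hτ l y _

/-- Here the minimiser for m is itself a competitor for t. -/
lemma postSS_le_of_postMean (hGt : IsUnit (gram X t)) (hGm : IsUnit (gram X m)) (htm : t ⊆ m)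
    {τ : ℝ} (hτ : 0 < τ) (l : ℝ) {y : Fin n → ℝ}
    (h : ∀ j : m, (j : Fin p) ∉ t → postMean X m τ y j = 0) :
    postSS X t τ l y ≤ postSS X m τ l y := by
  rw [postSS_eq_ridgeLoss hGm hτ, ← extend_coe (postMean X m τ y), ridgeLoss_subset htm
    fun j hj hjt => by simp only [extend, hj, dif_pos]; exact h ⟨j, hj⟩ hjt]
  exact postSS_le hGt hτ l y _

variable (X k) in
/-- The matrix of the quadratic form `postSS`. -/
def residMatrix (τ : ℝ) : Matrix (Fin n) (Fin n) ℝ :=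
  1 - design X k * postScale X k τ * (design X k)ᵀ

lemma postSS_eq_residMatrix (τ l : ℝ) (y : Fin n → ℝ) :
    postSS X k τ l y = l + y ⬝ᵥ (residMatrix X k τ *ᵥ y) := by
  have : y ⬝ᵥ ((design X k * postScale X k τ * (design X k)ᵀ) *ᵥ y) =
      ((design X k)ᵀ *ᵥ y) ⬝ᵥ (postScale X k τ *ᵥ ((design X k)ᵀ *ᵥ y)) := by
    rw [Matrix.mul_assoc, ← Matrix.mulVec_mulVec, Matrix.dotProduct_mulVec,
      ← Matrix.mulVec_transpose,
      ← Matrix.mulVec_mulVec]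
  rw [postSS, residMatrix, Matrix.sub_mulVec, dotProduct_sub, Matrix.one_mulVec, this]
  ring

lemma residMatrix_isHermitian (hG : IsUnit (gram X k)) {τ : ℝ} (hτ : 0 < τ) :
    (residMatrix X k τ).IsHermitian := by
  have h : (postScale X k τ).IsHermitian := by
    rw [postScale_eq hG]
    exact (precision_posDef hG hτ).inv.isHermitian
  refine Matrix.isHermitian_one.sub ?_
  have := Matrix.isHermitian_mul_mul_conjTranspose (design X k) h
  rwa [Matrix.conjTranspose_eq_transpose_of_trivial] at this

variable (X t m) in
/-- The matrix of the decrease of `postSS` from `t` to `m`. -/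
def dropMatrix (τ : ℝ) : Matrix (Fin n) (Fin n) ℝ := residMatrix X t τ - residMatrix X m τ

lemma dotProduct_dropMatrix (τ l : ℝ) (y : Fin n → ℝ) :
    y ⬝ᵥ (dropMatrix X t m τ *ᵥ y) = postSS X t τ l y - postSS X m τ l y := by
  rw [dropMatrix, Matrix.sub_mulVec, dotProduct_sub, postSS_eq_residMatrix, postSS_eq_residMatrix]
  ring

lemma dropMatrix_posSemidef (hGt : IsUnit (gram X t)) (hGm : IsUnit (gram X m)) (htm : t ⊆ m)
    {τ : ℝ} (hτ : 0 < τ) : (dropMatrix X t m τ).PosSemidef := by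
  refine Matrix.PosSemidef.of_dotProduct_mulVec_nonneg
    ((residMatrix_isHermitian hGt hτ).sub (residMatrix_isHermitian hGm hτ)) fun y => ?_
  rw [star_trivial, dotProduct_dropMatrix τ 0, sub_nonneg]
  exact postSS_anti hGt hGm htm hτ 0 y

lemma postSS_zero_nonneg (hG : IsUnit (gram X k)) {τ : ℝ} (hτ : 0 < τ) (y : Fin n → ℝ) :
    0 ≤ postSS X k τ 0 y := by
  rw [postSS_eq_ridgeLoss hG hτ, zero_add]
  exact ridgeLoss_nonneg hτ _ _

/-- The zero coefficient vector has loss y'y under t, and the minimum under m is nonnegative. -/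
lemma dropMatrix_le (hGt : IsUnit (gram X t)) (hGm : IsUnit (gram X m))
    {τ : ℝ} (hτ : 0 < τ) (y : Fin n → ℝ) :
    y ⬝ᵥ (dropMatrix X t m τ *ᵥ y) ≤ y ⬝ᵥ y := by
  rw [dotProduct_dropMatrix τ 0]
  have h1 := postSS_le hGt hτ 0 y 0
  have h2 := postSS_zero_nonneg hGm hτ y
  simp only [ridgeLoss, Matrix.mulVec_zero, sub_zero, Pi.zero_apply] at h1
  simp at h1
  linarith

/-- The true coefficients fit the noiseless data exactly, leaving only the ridge term, which the
smallest eigenvalue controls. -/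
lemma dropMatrix_mean_le (hGt : IsUnit (gram X t)) (hGm : IsUnit (gram X m)) (ht : t.Nonempty)
    {τ : ℝ} (hτ : 0 < τ) (θ : t → ℝ) :
    (design X t *ᵥ θ) ⬝ᵥ (dropMatrix X t m τ *ᵥ (design X t *ᵥ θ)) ≤
      (design X t *ᵥ θ) ⬝ᵥ (design X t *ᵥ θ) / (τ * minEig X t) := by
  rw [dotProduct_dropMatrix τ 0]
  have h1 := postSS_le hGt hτ 0 (design X t *ᵥ θ) θ
  have h2 := postSS_zero_nonneg hGm hτ (design X t *ᵥ θ)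
  have h3 := minEig_mul_sum_le hGt θ
  have hρ := minEig_pos hGt ht
  simp only [ridgeLoss, sub_self, zero_dotProduct, zero_add] at h1
  have h4 : τ⁻¹ * ∑ j, gram X t j j * θ j ^ 2 ≤
      (design X t *ᵥ θ) ⬝ᵥ (design X t *ᵥ θ) / (τ * minEig X t) := by
    rw [le_div_iff₀ (by positivity)]
    calc _ = minEig X t * ∑ j, gram X t j j * θ j ^ 2 := by field_simp
      _ ≤ _ := h3
  linarith

/-- Nonnegativity of the form at δv - u, divided by δ. The noise coefficient 1 + δ must stay near 1;
the signal can bear 1 + 1/δ. -/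
lemma quadratic_form_add_le {R : Matrix (Fin n) (Fin n) ℝ} (hR : R.PosSemidef) {δ : ℝ}
    (hδ : 0 < δ) (u v : Fin n → ℝ) :
    (u + v) ⬝ᵥ (R *ᵥ (u + v)) ≤ (1 + δ) * (v ⬝ᵥ (R *ᵥ v)) + (1 + 1 / δ) * (u ⬝ᵥ (R *ᵥ u)) := by
  have h := hR.dotProduct_mulVec_nonneg (δ • v - u)
  rw [star_trivial] at h
  simp only [Matrix.mulVec_sub, Matrix.mulVec_add, Matrix.mulVec_smul, sub_dotProduct,
    add_dotProduct, dotProduct_sub, dotProduct_add, smul_dotProduct, dotProduct_smul,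
    smul_eq_mul] at h ⊢
  have h2 : 0 ≤ 1 / δ * (δ * (δ * v ⬝ᵥ R *ᵥ v) - δ * v ⬝ᵥ R *ᵥ u -
      (δ * u ⬝ᵥ R *ᵥ v - u ⬝ᵥ R *ᵥ u)) := mul_nonneg (by positivity) (by linarith)
  have h3 : 1 / δ * (δ * (δ * v ⬝ᵥ R *ᵥ v) - δ * v ⬝ᵥ R *ᵥ u -
      (δ * u ⬝ᵥ R *ᵥ v - u ⬝ᵥ R *ᵥ u)) = δ * v ⬝ᵥ R *ᵥ v - v ⬝ᵥ R *ᵥ u - u ⬝ᵥ R *ᵥ v +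
        1 / δ * u ⬝ᵥ R *ᵥ u := by
    field_simp
    ring
  linarith

variable (X m) in
/-- The orthogonal complement of the column space of the design matrix. -/
def residSpace : Submodule ℝ (EuclideanSpace ℝ (Fin n)) :=
  LinearMap.ker ((design X m)ᵀ.mulVecLin ∘ₗ (WithLp.linearEquiv 2 ℝ (Fin n → ℝ)).toLinearMap)

variable (X t m) in
/-- The coefficients of the posterior mean under `m` outside `t`, as a linear map of the data. -/
def extraCoef (τ : ℝ) : EuclideanSpace ℝ (Fin n) →ₗ[ℝ] ({j : m // (j : Fin p) ∉ t} → ℝ) :=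
  LinearMap.funLeft ℝ ℝ Subtype.val ∘ₗ (postScale X m τ).mulVecLin ∘ₗ
    (design X m)ᵀ.mulVecLin ∘ₗ (WithLp.linearEquiv 2 ℝ (Fin n → ℝ)).toLinearMap

lemma extraCoef_apply (τ : ℝ) (v : EuclideanSpace ℝ (Fin n)) (j : {j : m // (j : Fin p) ∉ t}) :
    extraCoef X t m τ v j = postMean X m τ v.ofLp j := rfl

variable (X t m) in
/-- The directions of the data that affect the coefficients in `m` outside `t`. -/
def extraSpace (τ : ℝ) : Submodule ℝ (EuclideanSpace ℝ (Fin n)) :=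
  (LinearMap.ker (extraCoef X t m τ))ᗮ

lemma residSpace_le (τ : ℝ) : residSpace X m ≤ LinearMap.ker (extraCoef X t m τ) := by
  intro v hv
  rw [LinearMap.mem_ker]
  funext j
  have h : (design X m)ᵀ *ᵥ v.ofLp = 0 := hv
  rw [extraCoef_apply, postMean, h, Matrix.mulVec_zero]
  rfl

lemma residSpace_isOrtho (τ : ℝ) : residSpace X m ⟂ extraSpace X t m τ :=
  (Submodule.isOrtho_orthogonal_right _).mono_left (residSpace_le τ)

/-- Rank-nullity: the dimension is the rank of a map into a space with one coordinate per column in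
m outside t. -/
lemma finrank_extraSpace_le (htm : t ⊆ m) (τ : ℝ) :
    finrank ℝ (extraSpace X t m τ) + t.card ≤ m.card := by
  have h1 := (LinearMap.ker (extraCoef X t m τ)).finrank_add_finrank_orthogonal
  have h2 := (extraCoef X t m τ).finrank_range_add_finrank_ker
  have h3 := Submodule.finrank_le (LinearMap.range (extraCoef X t m τ))
  rw [finrank_fintype_fun_eq_card] at h3
  have h4 : Fintype.card {j : m // (j : Fin p) ∉ t} + t.card = m.card := by
    have e : {j : m // (j : Fin p) ∉ t} ≃ ↥(m \ t) :=
      { toFun := fun j => ⟨j.1.1, Finset.mem_sdiff.2 ⟨j.1.2, j.2⟩⟩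
        invFun := fun j => ⟨⟨j.1, (Finset.mem_sdiff.1 j.2).1⟩, (Finset.mem_sdiff.1 j.2).2⟩
        left_inv := fun _ => rfl
        right_inv := fun _ => rfl }
    rw [Fintype.card_congr e, Fintype.card_coe]
    exact Finset.card_sdiff_add_card_eq_card htm
  unfold extraSpace
  omega

lemma le_finrank_residSpace : n ≤ finrank ℝ (residSpace X m) + m.card := by
  set L := (design X m)ᵀ.mulVecLin ∘ₗ (WithLp.linearEquiv 2 ℝ (Fin n → ℝ)).toLinearMap with hL
  have h2 : finrank ℝ (LinearMap.range L) + finrank ℝ (residSpace X m) = n := by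
    exact L.finrank_range_add_finrank_ker.trans (finrank_euclideanSpace_fin (𝕜 := ℝ) (n := n))
  have h3 := Submodule.finrank_le (LinearMap.range L)
  rw [finrank_fintype_fun_eq_card, Fintype.card_coe] at h3
  omega

lemma dotProduct_self_eq_norm (v : EuclideanSpace ℝ (Fin n)) :
    v.ofLp ⬝ᵥ v.ofLp = ‖v‖ ^ 2 := by
  rw [EuclideanSpace.real_norm_sq_eq]
  exact Finset.sum_congr rfl fun i _ => (sq _).symm

lemma dropMatrix_mulVec_ker (hGt : IsUnit (gram X t)) (hGm : IsUnit (gram X m)) (htm : t ⊆ m)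
    {τ : ℝ} (hτ : 0 < τ) {v : EuclideanSpace ℝ (Fin n)}
    (hv : v ∈ LinearMap.ker (extraCoef X t m τ)) : dropMatrix X t m τ *ᵥ v.ofLp = 0 := by
  have hR := dropMatrix_posSemidef hGt hGm htm hτ
  refine (hR.dotProduct_mulVec_zero_iff v.ofLp).1 (le_antisymm ?_ (hR.dotProduct_mulVec_nonneg _))
  rw [star_trivial, dotProduct_dropMatrix τ 0, sub_nonpos]
  exact postSS_le_of_postMean hGt hGm htm hτ 0 fun j hj => congrFun hv ⟨j, hj⟩

/-- The form vanishes on the kernel of `extraCoef`, so only the component in its orthogonal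
complement counts, and there the form is at most the identity. -/
lemma dropMatrix_le_extraSpace (hGt : IsUnit (gram X t)) (hGm : IsUnit (gram X m)) (htm : t ⊆ m)
    {τ : ℝ} (hτ : 0 < τ) (v : EuclideanSpace ℝ (Fin n)) :
    v.ofLp ⬝ᵥ (dropMatrix X t m τ *ᵥ v.ofLp) ≤
      ‖(extraSpace X t m τ).orthogonalProjectionOnto v‖ ^ 2 := by
  set u : EuclideanSpace ℝ (Fin n) :=
    ((extraSpace X t m τ).orthogonalProjectionOnto v : extraSpace X t m τ).1
  have hw : v - u ∈ LinearMap.ker (extraCoef X t m τ) := by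
    have h := (extraSpace X t m τ).sub_starProjection_mem_orthogonal v
    rwa [extraSpace, Submodule.orthogonal_orthogonal] at h
  have h0 := dropMatrix_mulVec_ker hGt hGm htm hτ hw
  have hv : v.ofLp = u.ofLp + (v - u).ofLp := by
    rw [← WithLp.ofLp_add]; congr 1; abel
  have hsymm : ∀ a b : Fin n → ℝ, a ⬝ᵥ (dropMatrix X t m τ *ᵥ b) =
      b ⬝ᵥ (dropMatrix X t m τ *ᵥ a) := by
    intro a b
    have hT : (dropMatrix X t m τ)ᵀ = dropMatrix X t m τ := by
      have := (dropMatrix_posSemidef hGt hGm htm hτ).isHermitian.eq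
      rwa [Matrix.conjTranspose_eq_transpose_of_trivial] at this
    rw [Matrix.dotProduct_mulVec, ← Matrix.mulVec_transpose, hT, dotProduct_comm]
  calc v.ofLp ⬝ᵥ (dropMatrix X t m τ *ᵥ v.ofLp)
      = u.ofLp ⬝ᵥ (dropMatrix X t m τ *ᵥ u.ofLp) := by
        rw [hv, Matrix.mulVec_add, h0, add_zero, add_dotProduct, hsymm (v - u).ofLp, h0,
          dotProduct_zero, add_zero]
    _ ≤ u.ofLp ⬝ᵥ u.ofLp := dropMatrix_le hGt hGm hτ _
    _ = _ := by rw [dotProduct_self_eq_norm]; rfl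

/-- Signal and fit both lie in the column space of X_m, so the residual and the noise have the same
projection to `residSpace`. -/
lemma le_postSS (hGm : IsUnit (gram X m)) (htm : t ⊆ m) {τ : ℝ} (hτ : 0 < τ) (l : ℝ)
    (θ : t → ℝ) (v : EuclideanSpace ℝ (Fin n)) :
    l + ‖(residSpace X m).orthogonalProjectionOnto v‖ ^ 2 ≤
      postSS X m τ l (design X t *ᵥ θ + v.ofLp) := by
  rw [postSS_eq_ridgeLoss hGm hτ]
  set b := postMean X m τ (design X t *ᵥ θ + v.ofLp)
  have hθ : design X t *ᵥ θ = design X m *ᵥ fun j : m => extend θ j := by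
    rw [design_mulVec_subset htm fun j _ hj => by simp [extend, hj], extend_coe]
  set w : m → ℝ := (fun j : m => extend θ j) - b with hw
  have h1 : (design X t *ᵥ θ + v.ofLp) - design X m *ᵥ b =
      (v + WithLp.toLp 2 (design X m *ᵥ w)).ofLp := by
    rw [hθ, WithLp.ofLp_add, WithLp.ofLp_toLp, hw, Matrix.mulVec_sub]
    funext i
    simp only [Pi.add_apply, Pi.sub_apply]
    ring
  have h2 : (residSpace X m).orthogonalProjectionOnto (WithLp.toLp 2 (design X m *ᵥ w)) = 0 := by
    rw [Submodule.orthogonalProjectionOnto_eq_zero_iff, Submodule.mem_orthogonal]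
    intro a ha
    have ha' : (design X m)ᵀ *ᵥ a.ofLp = 0 := ha
    rw [EuclideanSpace.inner_eq_star_dotProduct, star_trivial, dotProduct_comm,
      Matrix.dotProduct_mulVec, ← Matrix.mulVec_transpose, ha', zero_dotProduct]
  have h3 : ‖(residSpace X m).orthogonalProjectionOnto v‖ ^ 2 ≤
      ‖v + WithLp.toLp 2 (design X m *ᵥ w)‖ ^ 2 := by
    have h4 : (residSpace X m).orthogonalProjectionOnto v =
        (residSpace X m).orthogonalProjectionOnto (v + WithLp.toLp 2 (design X m *ᵥ w)) := by
      rw [map_add, h2, add_zero]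
    rw [h4]
    gcongr
    exact Submodule.norm_orthogonalProjectionOnto_apply_le _ _
  rw [ridgeLoss, h1, dotProduct_self_eq_norm]
  have h5 : 0 ≤ τ⁻¹ * ∑ j, gram X m j j * b j ^ 2 :=
    mul_nonneg (inv_nonneg.2 hτ.le)
      (Finset.sum_nonneg fun j _ => mul_nonneg (gram_diag_nonneg j) (sq_nonneg _))
  linarith

/-- A bound for the ratio of the posterior sums of squares of nested models, in terms of the
standardised errors. -/
lemma postSS_ratio_le (hGt : IsUnit (gram X t)) (hGm : IsUnit (gram X m)) (htm : t ⊆ m)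
    (ht : t.Nonempty) {τ φ δ l : ℝ} (hτ : 0 < τ) (hφ : 0 < φ) (hδ : 0 < δ) (hl : 0 < l)
    (θ : t → ℝ) (v : EuclideanSpace ℝ (Fin n)) :
    postSS X t τ l (design X t *ᵥ θ + √φ • v.ofLp) /
        postSS X m τ l (design X t *ᵥ θ + √φ • v.ofLp) ≤
      1 + ((1 + δ) * ‖(extraSpace X t m τ).orthogonalProjectionOnto v‖ ^ 2 + (1 + 1 / δ) *
        ((design X t *ᵥ θ) ⬝ᵥ (design X t *ᵥ θ) / φ / (τ * minEig X t))) /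
        (l / φ + ‖(residSpace X m).orthogonalProjectionOnto v‖ ^ 2) := by
  set y := design X t *ᵥ θ + √φ • v.ofLp with hy
  have hR := dropMatrix_posSemidef hGt hGm htm hτ
  have hpos : 0 < postSS X m τ l y := postSS_pos hGm hτ hl y
  have hρ := minEig_pos hGt ht
  have h1 := quadratic_form_add_le hR hδ (design X t *ᵥ θ) (√φ • v.ofLp)
  have h2 : (√φ • v.ofLp) ⬝ᵥ (dropMatrix X t m τ *ᵥ (√φ • v.ofLp)) ≤
      φ * ‖(extraSpace X t m τ).orthogonalProjectionOnto v‖ ^ 2 := by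
    rw [Matrix.mulVec_smul, dotProduct_smul, smul_dotProduct, smul_eq_mul, smul_eq_mul,
      ← mul_assoc, Real.mul_self_sqrt hφ.le]
    gcongr
    exact dropMatrix_le_extraSpace hGt hGm htm hτ v
  have h3 := dropMatrix_mean_le hGt hGm ht hτ θ
  have h4 : φ * (l / φ + ‖(residSpace X m).orthogonalProjectionOnto v‖ ^ 2) ≤
      postSS X m τ l y := by
    have := le_postSS hGm htm hτ l θ (√φ • v)
    rw [map_smul, norm_smul, mul_pow, Real.norm_of_nonneg (Real.sqrt_nonneg _),
      Real.sq_sqrt hφ.le] at this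
    calc _ = l + φ * ‖(residSpace X m).orthogonalProjectionOnto v‖ ^ 2 := by field_simp
      _ ≤ _ := this
  have h5 : 0 < l / φ + ‖(residSpace X m).orthogonalProjectionOnto v‖ ^ 2 := by positivity
  have h6 : postSS X t τ l y / postSS X m τ l y =
      1 + y ⬝ᵥ (dropMatrix X t m τ *ᵥ y) / postSS X m τ l y := by
    rw [dotProduct_dropMatrix τ l]
    field_simp
    ring
  rw [h6]
  gcongr 1 + ?_
  calc y ⬝ᵥ (dropMatrix X t m τ *ᵥ y) / postSS X m τ l y
      ≤ y ⬝ᵥ (dropMatrix X t m τ *ᵥ y) /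
        (φ * (l / φ + ‖(residSpace X m).orthogonalProjectionOnto v‖ ^ 2)) := by
        refine div_le_div_of_nonneg_left (hR.dotProduct_mulVec_nonneg y) (by positivity) h4
    _ ≤ (φ * ((1 + δ) * ‖(extraSpace X t m τ).orthogonalProjectionOnto v‖ ^ 2 + (1 + 1 / δ) *
        ((design X t *ᵥ θ) ⬝ᵥ (design X t *ᵥ θ) / φ / (τ * minEig X t)))) /
        (φ * (l / φ + ‖(residSpace X m).orthogonalProjectionOnto v‖ ^ 2)) := by
        refine div_le_div_of_nonneg_right ?_ (by positivity)
        refine h1.trans ?_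
        have h7 : φ * ((1 + δ) * ‖(extraSpace X t m τ).orthogonalProjectionOnto v‖ ^ 2 +
            (1 + 1 / δ) * ((design X t *ᵥ θ) ⬝ᵥ (design X t *ᵥ θ) / φ / (τ * minEig X t))) =
            (1 + δ) * (φ * ‖(extraSpace X t m τ).orthogonalProjectionOnto v‖ ^ 2) +
            (1 + 1 / δ) * ((design X t *ᵥ θ) ⬝ᵥ (design X t *ᵥ θ) / (τ * minEig X t)) := by
          field_simp
        rw [h7]
        gcongr
    _ = _ := mul_div_mul_left _ _ hφ.ne'

end Nested

/-! ### From posterior odds to a finite-sample bound. -/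

section Posterior

open Module

lemma truth_eq_map_stdGaussian {n : ℕ} (μ : Fin n → ℝ) {φ : ℝ} (hφ : 0 < φ) :
    truth μ φ = (stdGaussian (EuclideanSpace ℝ (Fin n))).map fun v => μ + √φ • v.ofLp := by
  have h : ∀ i, (gaussianReal 0 1).map (fun x => μ i + √φ * x) =
      gaussianReal (μ i) φ.toNNReal := fun i => by
    have h1 : (fun x => μ i + √φ * x) = (fun x => μ i + x) ∘ fun x => √φ * x := rfl
    rw [h1, ← Measure.map_map (by fun_prop) (by fun_prop), gaussianReal_map_const_mul,
      gaussianReal_map_const_add]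
    congr 1
    · ring
    · ext
      simp [Real.sq_sqrt hφ.le, hφ.le]
  rw [← map_pi_eq_stdGaussian, Measure.map_map (by fun_prop) (by fun_prop), truth]
  simp_rw [← h]
  rw [← Measure.pi_map_pi (fun i => by fun_prop)]
  rfl

lemma min_one_le_rpow {B α : ℝ} (hB : 0 ≤ B) (hα0 : 0 < α) (hα1 : α ≤ 1) : min 1 B ≤ B ^ α := by
  rcases hB.eq_or_lt with rfl | hB
  · exact (min_le_right _ _).trans (by positivity)
  rcases le_total B 1 with h | h
  · refine (min_le_right _ _).trans ?_
    simpa using Real.rpow_le_rpow_of_exponent_ge hB h hα1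
  · exact (min_le_left _ _).trans (Real.one_le_rpow h hα0.le)

variable {n : ℕ} {P : Problem n}

lemma Problem.IsAdmissible.term_nonneg (hP : P.IsAdmissible) {a l : ℝ} (ha : 0 < a) (hl : 0 < l)
    (y : Fin n → ℝ) {i : Finset (Fin P.p)} (hi : i ∈ P.models) :
    0 ≤ marginalLik P.X i P.τ a l y * P.prior i :=
  mul_nonneg (marginalLik_nonneg hP.tau_pos ha hl y) (hP.prior_pos i hi).le

lemma Problem.IsAdmissible.postProb_nonneg (hP : P.IsAdmissible) {a l : ℝ} (ha : 0 < a)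
    (hl : 0 < l) (y : Fin n → ℝ) : 0 ≤ postProb P.X P.m P.models P.prior P.τ a l y :=
  div_nonneg (hP.term_nonneg ha hl y hP.m_mem)
    (Finset.sum_nonneg fun _ hi => hP.term_nonneg ha hl y hi)

lemma Problem.IsAdmissible.postProb_le_one (hP : P.IsAdmissible) {a l : ℝ} (ha : 0 < a)
    (hl : 0 < l) (y : Fin n → ℝ) : postProb P.X P.m P.models P.prior P.τ a l y ≤ 1 :=
  div_le_one_of_le₀
    (Finset.single_le_sum (f := fun i => marginalLik P.X i P.τ a l y * P.prior i)
      (fun _ hi => hP.term_nonneg ha hl y hi) hP.m_mem)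
    (Finset.sum_nonneg fun _ hi => hP.term_nonneg ha hl y hi)

/-- Only the term of t is kept in the normalising sum. -/
lemma Problem.IsAdmissible.postProb_le_div (hP : P.IsAdmissible) {a l : ℝ} (ha : 0 < a)
    (hl : 0 < l) (y : Fin n → ℝ) (ht : 0 < marginalLik P.X P.t P.τ a l y) :
    postProb P.X P.m P.models P.prior P.τ a l y ≤
      marginalLik P.X P.m P.τ a l y * P.prior P.m /
        (marginalLik P.X P.t P.τ a l y * P.prior P.t) :=
  div_le_div_of_nonneg_left (hP.term_nonneg ha hl y hP.m_mem)
    (mul_pos ht (hP.prior_pos _ hP.t_mem))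
    (Finset.single_le_sum (f := fun i => marginalLik P.X i P.τ a l y * P.prior i)
      (fun _ hi => hP.term_nonneg ha hl y hi) hP.t_mem)

/-- The posterior odds of `m` against `t`, as a product of four ratios. -/
lemma Problem.IsAdmissible.odds_eq (hP : P.IsAdmissible) {a l : ℝ} (ha : 0 < a)
    (hl : 0 < l) (y : Fin n → ℝ) :
    marginalLik P.X P.m P.τ a l y * P.prior P.m / (marginalLik P.X P.t P.τ a l y * P.prior P.t) =
      P.r * penaltyRatio P.X P.m P.t P.τ a l y * (eigProd P.X P.t P.τ / eigProd P.X P.m P.τ) *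
        (postSS P.X P.t P.τ l y / postSS P.X P.m P.τ l y) ^ ((a + n) / 2) := by
  have hGt := hP.gram_isUnit _ hP.t_mem
  have hGm := hP.gram_isUnit _ hP.m_mem
  have hst := postSS_pos hGt hP.tau_pos hl y
  have hsm := postSS_pos hGm hP.tau_pos hl y
  have het := eigProd_pos hGt hP.tau_pos
  have hem := eigProd_pos hGm hP.tau_pos
  have hEt := postPenalty_pos hGt hP.tau_pos ha hl y
  have hL := likConst_pos n ha hl
  have hπ := hP.prior_pos _ hP.t_mem
  have hratio : (postSS P.X P.t P.τ l y / postSS P.X P.m P.τ l y) ^ ((a + n) / 2) =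
      (postSS P.X P.m P.τ l y / 2) ^ (-((a + n) / 2)) /
        (postSS P.X P.t P.τ l y / 2) ^ (-((a + n) / 2)) := by
    rw [← Real.div_rpow (by positivity) (by positivity), Real.rpow_neg (by positivity),
      ← Real.inv_rpow (by positivity)]
    congr 1
    field_simp
  rw [marginalLik_eq hGt hP.tau_pos ha hl, marginalLik_eq hGm hP.tau_pos ha hl, hratio,
    Problem.r, penaltyRatio]
  have hst2 : 0 < (postSS P.X P.t P.τ l y / 2) ^ (-((a + n) / 2)) := by positivity
  field_simp

lemma Problem.IsAdmissible.postProb_le (hP : P.IsAdmissible) {a l H α : ℝ} (ha : 0 < a)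
    (hl : 0 < l) (y : Fin n → ℝ) (hα0 : 0 < α) (hα1 : α ≤ 1)
    (hH : penaltyRatio P.X P.m P.t P.τ a l y ≤ H) (hH0 : 0 ≤ H) :
    postProb P.X P.m P.models P.prior P.τ a l y ≤
      (P.r * H * (eigProd P.X P.t P.τ / eigProd P.X P.m P.τ)) ^ α *
        (postSS P.X P.t P.τ l y / postSS P.X P.m P.τ l y) ^ (α * ((a + n) / 2)) := by
  have hGt := hP.gram_isUnit _ hP.t_mem
  have hGm := hP.gram_isUnit _ hP.m_mem
  have hst := postSS_pos hGt hP.tau_pos hl y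
  have hsm := postSS_pos hGm hP.tau_pos hl y
  have het := eigProd_pos hGt hP.tau_pos
  have hem := eigProd_pos hGm hP.tau_pos
  have hr : 0 < P.r := div_pos (hP.prior_pos _ hP.m_mem) (hP.prior_pos _ hP.t_mem)
  have hLt : 0 < marginalLik P.X P.t P.τ a l y := by
    rw [marginalLik_eq hGt hP.tau_pos ha hl]
    have := postPenalty_pos hGt hP.tau_pos ha hl y
    have := likConst_pos n ha hl
    positivity
  have h1 := hP.postProb_le_div ha hl y hLt
  rw [hP.odds_eq ha hl] at h1
  set W := postSS P.X P.t P.τ l y / postSS P.X P.m P.τ l y with hW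
  have hW0 : 0 < W := by positivity
  have h2 : postProb P.X P.m P.models P.prior P.τ a l y ≤
      P.r * H * (eigProd P.X P.t P.τ / eigProd P.X P.m P.τ) * W ^ ((a + n) / 2) :=
    h1.trans (by gcongr)
  refine (le_min (hP.postProb_le_one ha hl y) h2).trans ?_
  refine (min_one_le_rpow (by positivity) hα0 hα1).trans (le_of_eq ?_)
  rw [Real.mul_rpow (by positivity) (by positivity), ← Real.rpow_mul hW0.le, mul_comm α]

lemma measurable_postSS {p : ℕ} (X : Matrix (Fin n) (Fin p) ℝ) (k : Finset (Fin p)) (τ l : ℝ) :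
    Measurable (postSS X k τ l) := by
  have h : Continuous (postSS X k τ l) := by
    unfold postSS
    fun_prop
  exact h.measurable

/-- Spares a proof that the posterior probability is measurable in y: otherwise its integral is 0 by
convention. -/
lemma integral_le_toReal_lintegral {Ω : Type*} [MeasurableSpace Ω] (μ : Measure Ω) {f : Ω → ℝ}
    (hf : ∀ y, 0 ≤ f y) :
    ∫ y, f y ∂μ ≤ (∫⁻ y, ENNReal.ofReal (f y) ∂μ).toReal := by
  by_cases hm : AEStronglyMeasurable f μ
  · rw [integral_eq_lintegral_of_nonneg_ae (ae_of_all _ hf) hm]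
  · rw [integral_undef fun h => hm h.1]
    exact ENNReal.toReal_nonneg

lemma isProbabilityMeasure_law (P : Problem n) : IsProbabilityMeasure P.law := by
  unfold Problem.law truth
  infer_instance

lemma Problem.IsAdmissible.lintegral_ratio_le (hP : P.IsAdmissible) {l γ θ δ : ℝ} (hl : 0 < l)
    (hγ : 0 ≤ γ) (hθ : 0 < θ) (hθ1 : θ ≤ 1) (hδ : 0 < δ) (hδθ : θ * (1 + δ) < 1)
    (hd : 2 * (γ / θ) + 2 + P.m.card ≤ n)
    (hη : (1 + 1 / δ) * (P.noncentrality / (P.τ * minEig P.X P.t)) ≤ 1) :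
    ∫⁻ y, ENNReal.ofReal ((postSS P.X P.t P.τ l y / postSS P.X P.m P.τ l y) ^ γ) ∂P.law ≤
      ENNReal.ofReal (Real.exp (θ / 2) * (1 - θ * (1 + δ)) ^ (-(P.excess / 2))) := by
  have hGt := hP.gram_isUnit _ hP.t_mem
  have hGm := hP.gram_isUnit _ hP.m_mem
  have hρ := minEig_pos hGt hP.t_nonempty
  have hτ := hP.tau_pos
  have hφ := hP.phi_pos
  have hsub := hP.t_ssubset_m.subset
  have hmean : 0 ≤ P.mean ⬝ᵥ P.mean := Finset.sum_nonneg fun _ _ => mul_self_nonneg _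
  have hη0 : 0 ≤ (1 + 1 / δ) * (P.noncentrality / (P.τ * minEig P.X P.t)) := by
    unfold Problem.noncentrality; positivity
  have hdK : 2 * (γ / θ) + 2 ≤ finrank ℝ (residSpace P.X P.m) := by
    have h1 : (n : ℝ) ≤ finrank ℝ (residSpace P.X P.m) + P.m.card := by
      exact_mod_cast le_finrank_residSpace (X := P.X) (m := P.m)
    linarith
  have hdU : (finrank ℝ (extraSpace P.X P.t P.m P.τ) : ℝ) ≤ P.excess := by
    have h1 : (finrank ℝ (extraSpace P.X P.t P.m P.τ) : ℝ) + P.t.card ≤ P.m.card := by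
      exact_mod_cast finrank_extraSpace_le (X := P.X) hsub P.τ
    unfold Problem.excess
    linarith
  rw [Problem.law, truth_eq_map_stdGaussian _ hφ]
  refine (lintegral_map_le _ _).trans ?_
  refine le_trans (lintegral_mono fun v => ?_)
    ((lintegral_rpow_ratio_stdGaussian_le (residSpace_isOrtho (X := P.X) (t := P.t) (m := P.m) P.τ)
      (l := l / P.φstar) (by positivity) hγ hθ hθ1 (by positivity) hη0 hδθ hdK).trans ?_)
  · refine ENNReal.ofReal_le_ofReal (Real.rpow_le_rpow ?_ ?_ hγ)
    · exact (div_pos (postSS_pos hGt hτ hl _) (postSS_pos hGm hτ hl _)).le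
    · exact postSS_ratio_le hGt hGm hsub hP.t_nonempty hτ hφ hδ hl P.θstar v
  · refine ENNReal.ofReal_le_ofReal ?_
    have h1 : 0 < 1 - θ * (1 + δ) := by linarith
    have h2 : 1 - θ * (1 + δ) ≤ 1 := by nlinarith
    refine mul_le_mul ?_ ?_ (by positivity) (by positivity)
    · refine Real.exp_le_exp.2 ?_
      have := mul_le_mul_of_nonneg_left hη hθ.le
      linarith
    -- The base is at most 1, so replacing the dimension of `extraSpace` by its upper bound can only
    -- increase the power.
    · exact Real.rpow_le_rpow_of_exponent_ge h1 h2 (by linarith)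

/-- A finite-sample bound for the expected posterior probability of the spurious model. -/
lemma Problem.IsAdmissible.integral_postProb_le (hP : P.IsAdmissible) {a l H α θ δ : ℝ}
    (ha : 0 < a) (hl : 0 < l) (hH : 0 ≤ H) (hα0 : 0 < α) (hα1 : α ≤ 1)
    (hθ : 0 < θ) (hθ1 : θ ≤ 1) (hδ : 0 < δ) (hδθ : θ * (1 + δ) < 1)
    (hd : 2 * (α * ((a + n) / 2) / θ) + 2 + P.m.card ≤ n)
    (hη : (1 + 1 / δ) * (P.noncentrality / (P.τ * minEig P.X P.t)) ≤ 1) :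
    ∫ y, postProb P.X P.m P.models P.prior P.τ a l y ∂P.law ≤
      (P.r * H * (eigProd P.X P.t P.τ / eigProd P.X P.m P.τ)) ^ α *
        (Real.exp (θ / 2) * (1 - θ * (1 + δ)) ^ (-(P.excess / 2))) +
      P.law.real {y | H < penaltyRatio P.X P.m P.t P.τ a l y} := by
  have hprob := isProbabilityMeasure_law P
  have hGt := hP.gram_isUnit _ hP.t_mem
  have hGm := hP.gram_isUnit _ hP.m_mem
  have het := eigProd_pos hGt hP.tau_pos
  have hem := eigProd_pos hGm hP.tau_pos
  have hr : 0 < P.r := div_pos (hP.prior_pos _ hP.m_mem) (hP.prior_pos _ hP.t_mem)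
  have hκ : 0 < 1 - θ * (1 + δ) := by linarith
  set S := {y | H < penaltyRatio P.X P.m P.t P.τ a l y} with hS
  set A := (P.r * H * (eigProd P.X P.t P.τ / eigProd P.X P.m P.τ)) ^ α with hA
  have hA0 : 0 ≤ A := by positivity
  set γ := α * ((a + n) / 2) with hγ
  have hmeas : Measurable fun y : Fin n → ℝ =>
      ENNReal.ofReal ((postSS P.X P.t P.τ l y / postSS P.X P.m P.τ l y) ^ γ) := by
    have h1 := measurable_postSS P.X P.t P.τ l
    have h2 := measurable_postSS P.X P.m P.τ l
    fun_prop
  have hle : ∫⁻ y, ENNReal.ofReal (postProb P.X P.m P.models P.prior P.τ a l y) ∂P.law ≤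
      ENNReal.ofReal A * ENNReal.ofReal
        (Real.exp (θ / 2) * (1 - θ * (1 + δ)) ^ (-(P.excess / 2))) + P.law S := by
    calc _ ≤ ∫⁻ y, (ENNReal.ofReal A * ENNReal.ofReal
          ((postSS P.X P.t P.τ l y / postSS P.X P.m P.τ l y) ^ γ) +
            S.indicator 1 y) ∂P.law := by
          refine lintegral_mono fun y => ?_
          by_cases hy : y ∈ S
          · rw [Set.indicator_of_mem hy]
            refine le_trans ?_ le_add_self
            exact ENNReal.ofReal_le_one.2 (hP.postProb_le_one ha hl y)
          · rw [Set.indicator_of_notMem hy, add_zero, ← ENNReal.ofReal_mul hA0]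
            refine ENNReal.ofReal_le_ofReal ?_
            exact hP.postProb_le ha hl y hα0 hα1 (not_lt.1 hy) hH
      _ ≤ _ := by
          rw [lintegral_add_left (hmeas.const_mul _),
            lintegral_const_mul' _ _ ENNReal.ofReal_ne_top]
          gcongr
          · exact hP.lintegral_ratio_le hl (by positivity) hθ hθ1 hδ hδθ hd hη
          -- This inequality holds without measurability of `S`.
          · exact lintegral_indicator_one_le S
  have hne : ENNReal.ofReal A * ENNReal.ofReal
        (Real.exp (θ / 2) * (1 - θ * (1 + δ)) ^ (-(P.excess / 2))) + P.law S ≠ ⊤ :=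
    ENNReal.add_ne_top.2 ⟨ENNReal.mul_ne_top ENNReal.ofReal_ne_top ENNReal.ofReal_ne_top,
      measure_ne_top _ _⟩
  refine (integral_le_toReal_lintegral _ (hP.postProb_nonneg ha hl)).trans ((ENNReal.toReal_mono hne hle).trans (le_of_eq ?_))
  rw [ENNReal.toReal_add (ENNReal.mul_ne_top ENNReal.ofReal_ne_top ENNReal.ofReal_ne_top)
    (measure_ne_top _ _), ENNReal.toReal_mul, ENNReal.toReal_ofReal hA0,
    ENNReal.toReal_ofReal (by positivity)]
  rfl

/-- The comparison of rates behind the final statement. -/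
lemma rate_le {r h τ q c C E κ α α' β s : ℝ} (hr : 0 < r) (hh : 1 ≤ h) (hτ : 1 ≤ τ) (hq : 1 ≤ q)
    (hc : 0 < c) (hC : 0 < C) (hE : 0 < E) (hκ : 0 < κ) (hα' : 0 ≤ α') (hαα' : α < α')
    (hβ1 : β ≤ 1) (hrβ : r ≤ τ ^ (β * q / 2)) (hEC : E ≤ C * (c * τ) ^ (-(q / 2)))
    (hs : 0 ≤ s)
    (hsmall : c ^ (-(α' / 2)) * κ ^ (-(1 / 2) : ℝ) * h ^ (-(α' - α)) ≤ 1) :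
    (r * (1 / h ^ q) * E) ^ α' * (s * κ ^ (-(q / 2))) ≤
      C ^ α' * s * (c ^ (-(α' / 2)) * κ ^ (-(1 / 2) : ℝ) * h ^ (-(α' - α))) *
        (r ^ α * (h * √τ) ^ (-(α * q))) := by
  have hh0 : 0 < h := by linarith
  have hτ0 : 0 < τ := by linarith
  -- The target rate is x^α, while the bound is of order x^{α'} times constants to the power q. By
  -- (C1), x ≤ h^{-q}, so the spare x^{α'-α} absorbs them.
  set x := r * h ^ (-q) * τ ^ (-(q / 2)) with hx
  have hx0 : 0 < x := by positivity
  have hg : r ^ α * (h * √τ) ^ (-(α * q)) = x ^ α := by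
    rw [hx, Real.mul_rpow (by positivity) (by positivity), Real.mul_rpow (by positivity)
      (by positivity), Real.mul_rpow (by positivity) (by positivity), ← Real.rpow_mul hh0.le,
      ← Real.rpow_mul hτ0.le, Real.sqrt_eq_rpow, ← Real.rpow_mul hτ0.le, ← mul_assoc]
    congr 2
    · congr 1; ring
    · ring
  have hxh : x ≤ h ^ (-q) := by
    have h1 : r ≤ τ ^ (q / 2) :=
      hrβ.trans (Real.rpow_le_rpow_of_exponent_le hτ (by nlinarith))
    calc x ≤ τ ^ (q / 2) * h ^ (-q) * τ ^ (-(q / 2)) := by rw [hx]; gcongr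
      _ = h ^ (-q) * (τ ^ (q / 2) * τ ^ (-(q / 2))) := by ring
      _ = h ^ (-q) := by rw [← Real.rpow_add hτ0, add_neg_cancel, Real.rpow_zero, mul_one]
  have hbase : r * (1 / h ^ q) * E ≤ C * c ^ (-(q / 2)) * x := by
    calc r * (1 / h ^ q) * E ≤ r * (1 / h ^ q) * (C * (c * τ) ^ (-(q / 2))) := by gcongr
      _ = _ := by
        rw [hx, Real.mul_rpow hc.le hτ0.le, Real.rpow_neg hh0.le, one_div]
        ring
  set B := c ^ (-(α' / 2)) * κ ^ (-(1 / 2) : ℝ) * h ^ (-(α' - α)) with hB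
  have hB0 : 0 < B := by positivity
  -- Since q ≥ 1 and B ≤ 1, one limit B → 0 handles every q, even when q varies with n.
  have hBq : B ^ q ≤ B := by
    simpa using Real.rpow_le_rpow_of_exponent_ge hB0 hsmall hq
  have hBq2 : B ^ q = (c ^ (-(q / 2))) ^ α' * κ ^ (-(q / 2)) * (h ^ (-q)) ^ (α' - α) := by
    rw [hB, Real.mul_rpow (by positivity) (by positivity), Real.mul_rpow (by positivity)
      (by positivity), ← Real.rpow_mul hc.le, ← Real.rpow_mul hκ.le, ← Real.rpow_mul hh0.le,
      ← Real.rpow_mul hc.le, ← Real.rpow_mul hh0.le,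
      show -(α' / 2) * q = -(q / 2) * α' by ring, show -(1 / 2) * q = -(q / 2) by ring,
      show -(α' - α) * q = -q * (α' - α) by ring]
  calc (r * (1 / h ^ q) * E) ^ α' * (s * κ ^ (-(q / 2)))
      ≤ (C * c ^ (-(q / 2)) * x) ^ α' * (s * κ ^ (-(q / 2))) := by
        gcongr
    _ = C ^ α' * s * ((c ^ (-(q / 2))) ^ α' * κ ^ (-(q / 2)) * x ^ (α' - α)) * x ^ α := by
        rw [Real.mul_rpow (by positivity) hx0.le, Real.mul_rpow hC.le (by positivity),
          show x ^ α' = x ^ (α' - α) * x ^ α by rw [← Real.rpow_add hx0]; congr 1; ring]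
        ring
    _ ≤ C ^ α' * s * ((c ^ (-(q / 2))) ^ α' * κ ^ (-(q / 2)) * (h ^ (-q)) ^ (α' - α)) *
          x ^ α := by
        have := sub_pos.2 hαα'
        gcongr
    _ ≤ C ^ α' * s * B * x ^ α := by
        rw [← hBq2]
        gcongr
    _ = _ := by rw [hg]

end Posterior

/-! ### Consequences of the asymptotic assumptions. -/

section Asymptotic

variable {P : (n : ℕ) → Problem n}

lemma eventually_dimension_le (hP : ∀ᶠ n in atTop, (P n).IsAdmissible)
    (hsize : (fun n => ((P n).pbar : ℝ)) =o[atTop] fun n => min (n : ℝ) ((P n).p : ℝ))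
    {α θ : ℝ} (a : ℝ) (hθ : 0 < θ) (hαθ : α < θ) :
    ∀ᶠ n : ℕ in atTop, 2 * (α * ((a + n) / 2) / θ) + 2 + (P n).m.card ≤ (n : ℝ) := by
  -- The slack (1 - α/θ)n is split in two: one half for p_m, the other for the bounded terms.
  set ε := (1 - α / θ) / 2 with hε
  have hε0 : 0 < ε := by
    have : α / θ < 1 := (div_lt_one hθ).2 hαθ
    rw [hε]; linarith
  filter_upwards [hP, isLittleO_iff.1 hsize hε0,
    (tendsto_natCast_atTop_atTop (R := ℝ)).eventually_ge_atTop ((α * a / θ + 2) / ε)]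
    with n hn hs hlarge
  have h1 : ((P n).m.card : ℝ) ≤ (P n).pbar := by
    exact_mod_cast Finset.le_sup (f := Finset.card) hn.m_mem
  rw [Real.norm_of_nonneg (by positivity), Real.norm_of_nonneg (by positivity)] at hs
  have h2 : ε * min (n : ℝ) ((P n).p : ℝ) ≤ ε * n :=
    mul_le_mul_of_nonneg_left (min_le_left _ _) hε0.le
  rw [div_le_iff₀ hε0] at hlarge
  have h3 : 2 * (α * ((a + n) / 2) / θ) = α * a / θ + (1 - 2 * ε) * n := by
    rw [hε]; field_simp; ring
  rw [h3]
  linarith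

lemma eventually_noncentrality_le (hP : ∀ᶠ n in atTop, (P n).IsAdmissible)
    (hD2 : (fun n => (P n).noncentrality) =o[atTop]
      fun n => (P n).τ * minEig (P n).X (P n).t) {A : ℝ} (hA : 0 < A) :
    ∀ᶠ n in atTop, A * ((P n).noncentrality / ((P n).τ * minEig (P n).X (P n).t)) ≤ 1 := by
  filter_upwards [hP, isLittleO_iff.1 hD2 (inv_pos.2 hA)] with n hn h
  have hpos : 0 < (P n).τ * minEig (P n).X (P n).t :=
    mul_pos hn.tau_pos (minEig_pos (hn.gram_isUnit _ hn.t_mem) hn.t_nonempty)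
  rw [Real.norm_of_nonneg hpos.le] at h
  have h1 := (Real.le_norm_self _).trans h
  rw [← div_le_iff₀ hpos] at h1
  calc _ ≤ A * A⁻¹ := by gcongr
    _ = 1 := mul_inv_cancel₀ hA.ne'

lemma exists_eigProd_ratio_le (hP : ∀ᶠ n in atTop, (P n).IsAdmissible) {c : ℝ} (hc : 0 < c)
    (h : (fun n => eigProd (P n).X (P n).m (P n).τ / eigProd (P n).X (P n).t (P n).τ) =Θ[atTop]
      fun n => (c * (P n).τ) ^ ((P n).excess / 2)) :
    ∃ C : ℝ, 0 < C ∧ ∀ᶠ n in atTop,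
      eigProd (P n).X (P n).t (P n).τ / eigProd (P n).X (P n).m (P n).τ ≤
        C * (c * (P n).τ) ^ (-((P n).excess / 2)) := by
  obtain ⟨C, hC, hb⟩ := h.2.exists_pos
  refine ⟨C, hC, ?_⟩
  filter_upwards [hP, hb.bound] with n hn h1
  have hτ := hn.tau_pos
  have het := eigProd_pos (hn.gram_isUnit _ hn.t_mem) hτ
  have hem := eigProd_pos (hn.gram_isUnit _ hn.m_mem) hτ
  rw [Real.norm_of_nonneg (by positivity), Real.norm_of_nonneg (by positivity)] at h1
  have h2 : 0 < (c * (P n).τ) ^ ((P n).excess / 2) := by positivity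
  rw [Real.rpow_neg (by positivity), ← div_eq_mul_inv, div_le_div_iff₀ hem h2]
  rw [← mul_div_assoc, le_div_iff₀ het] at h1
  linarith

lemma Problem.IsAdmissible.one_le_excess {n : ℕ} {P : Problem n} (hP : P.IsAdmissible) :
    1 ≤ P.excess := by
  have : P.t.card + 1 ≤ P.m.card := Finset.card_lt_card hP.t_ssubset_m
  have : (P.t.card : ℝ) + 1 ≤ P.m.card := by exact_mod_cast this
  unfold Problem.excess
  linarith

end Asymptotic

end MomSelection

end

/-! ### Choice of exponents and conclusion. -/

theorem proposition5
    -- the fixed parameters of the inverse gamma prior on the error variance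
    (aφ lφ : ℝ) (haφ : 0 < aφ) (hlφ : 0 < lφ)
    -- one problem for each sample size, and the acceleration factor
    (P : (n : ℕ) → MomSelection.Problem n) (h : ℕ → ℝ)
    (hP : ∀ᶠ n in Filter.atTop, (P n).IsAdmissible)
    (hh : Filter.Tendsto h Filter.atTop Filter.atTop)
    -- (B1)
    (hB1_size : (fun n => ((P n).pbar : ℝ)) =o[Filter.atTop]
      fun n => min (n : ℝ) ((P n).p : ℝ))
    (hB1_tau : (fun n => ((P n).pbar : ℝ)) =o[Filter.atTop] fun n => (P n).τ)
    -- (C1)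
    (hC1_tau : Filter.Tendsto (fun n => (P n).τ) Filter.atTop Filter.atTop)
    (hC1_prior : ∃ β : ℝ, 0 < β ∧ β < 1 ∧
      (fun n => (P n).r) =o[Filter.atTop] fun n => (P n).τ ^ (β * (P n).excess / 2))
    -- (D1)
    (hD1 : ∃ c : ℝ, 0 < c ∧
      (fun n => MomSelection.eigProd (P n).X (P n).m (P n).τ /
        MomSelection.eigProd (P n).X (P n).t (P n).τ) =Θ[Filter.atTop]
      fun n => (c * (P n).τ) ^ ((P n).excess / 2))
    -- (D2)
    (hD2 : (fun n => (P n).noncentrality) =o[Filter.atTop]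
      fun n => (P n).τ * MomSelection.minEig (P n).X (P n).t)
    (α κ : ℝ) (hα0 : 0 < α) (hα1 : α < 1) (hκ : 0 < κ) :
    ∃ b : ℕ → ℝ,
      b =o[Filter.atTop] (fun n =>
        max ((P n).r ^ α * (h n * Real.sqrt (P n).τ) ^ (-(α * (P n).excess)))
          (max (Real.exp (-(κ * n)))
            (Real.exp (-((P n).τ * MomSelection.minEig (P n).X (P n).t / 2))))) ∧
      ∀ᶠ n in Filter.atTop,
        ∫ y, MomSelection.postProb (P n).X (P n).m (P n).models (P n).prior
            (P n).τ aφ lφ y ∂(P n).law ≤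
          b n + (P n).law.real {y | 1 / h n ^ (P n).excess <
            MomSelection.penaltyRatio (P n).X (P n).m (P n).t (P n).τ aφ lφ y} := by
  obtain ⟨β, _, hβ1, hβ⟩ := hC1_prior
  obtain ⟨c, hc, hΘ⟩ := hD1
  obtain ⟨C, hC, hE⟩ := MomSelection.exists_eigProd_ratio_le hP hc hΘ
  -- Take α < α' < θ < 1. The first gap absorbs constants to the power q, the second leaves degrees
  -- of freedom for p_m, and the third leaves room for δ.
  obtain ⟨α', hαα', hα'1⟩ := exists_between hα1
  obtain ⟨θ, hαθ, hθ1⟩ := exists_between hα'1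
  have hα'0 : 0 < α' := hα0.trans hαα'
  have hθ0 : 0 < θ := hα'0.trans hαθ
  set δ := (1 - θ) / 2 with hδ
  have hδ0 : 0 < δ := by rw [hδ]; linarith
  have hδθ : θ * (1 + δ) < 1 := by rw [hδ]; nlinarith
  set κ₀ := 1 - θ * (1 + δ) with hκ₀
  have hκ₀0 : 0 < κ₀ := by rw [hκ₀]; linarith
  set K := c ^ (-(α' / 2)) * κ₀ ^ (-(1 / 2) : ℝ) with hK
  have hlim : Filter.Tendsto (fun n => K * h n ^ (-(α' - α))) Filter.atTop (nhds 0) := by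
    have := ((tendsto_rpow_neg_atTop (sub_pos.2 hαα')).comp hh).const_mul K
    rwa [mul_zero] at this
  -- The witness is the finite-sample bound with threshold h^{-q} and power α'.
  refine ⟨fun n => ((P n).r * (1 / h n ^ (P n).excess) *
    (MomSelection.eigProd (P n).X (P n).t (P n).τ /
      MomSelection.eigProd (P n).X (P n).m (P n).τ)) ^ α' *
    (Real.exp (θ / 2) * κ₀ ^ (-((P n).excess / 2))), ?_, ?_⟩
  · rw [Asymptotics.isLittleO_iff]
    intro ε hε
    have hCs : 0 < C ^ α' * Real.exp (θ / 2) := by positivity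
    filter_upwards [hP, hE, hlim.eventually_le_const one_pos,
      hlim.eventually_le_const (div_pos hε hCs), hh.eventually_ge_atTop 1,
      hC1_tau.eventually_ge_atTop 1, Asymptotics.isLittleO_iff.1 hβ one_pos]
      with n hn hEn hsmall hsmall' hh1 hτ1 hrβ
    have hτ := hn.tau_pos
    have het := MomSelection.eigProd_pos (hn.gram_isUnit _ hn.t_mem) hτ
    have hem := MomSelection.eigProd_pos (hn.gram_isUnit _ hn.m_mem) hτ
    have hr : 0 < (P n).r := div_pos (hn.prior_pos _ hn.m_mem) (hn.prior_pos _ hn.t_mem)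
    have hh0 : 0 < h n := by linarith
    rw [Real.norm_of_nonneg hr.le, Real.norm_of_nonneg (by positivity), one_mul] at hrβ
    have hrate := MomSelection.rate_le hr hh1 hτ1 hn.one_le_excess hc hC (div_pos het hem) hκ₀0
      hα'0.le hαα' hβ1.le hrβ hEn (Real.exp_pos (θ / 2)).le hsmall
    have hg : 0 ≤ (P n).r ^ α * (h n * Real.sqrt (P n).τ) ^ (-(α * (P n).excess)) := by
      positivity
    rw [Real.norm_of_nonneg (by positivity), Real.norm_of_nonneg (hg.trans (le_max_left _ _))]
    refine hrate.trans ?_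
    have hcoef : C ^ α' * Real.exp (θ / 2) * (K * h n ^ (-(α' - α))) ≤ ε := by
      rw [le_div_iff₀ hCs] at hsmall'
      linarith
    -- The witness is already negligible against the first entry of the maximum.
    calc _ ≤ ε * ((P n).r ^ α * (h n * Real.sqrt (P n).τ) ^ (-(α * (P n).excess))) :=
          mul_le_mul_of_nonneg_right hcoef hg
      _ ≤ _ := mul_le_mul_of_nonneg_left (le_max_left _ _) hε.le
  · filter_upwards [hP, hh.eventually_ge_atTop 1,
      MomSelection.eventually_dimension_le hP hB1_size aφ hθ0 hαθ,
      MomSelection.eventually_noncentrality_le hP hD2 (show 0 < 1 + 1 / δ by positivity)]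
      with n hn hh1 hd hη
    have hh0 : 0 < h n := by linarith
    exact hn.integral_postProb_le haφ hlφ (by positivity) hα'0 hα'1.le hθ0 hθ1.le hδ0 hδθ hd hη
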